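/- **Theorem (variational dual form of entropic optimal transport).** Let $D\in\mathbb{N}$, $\varepsilon>0$, and let $p_0,p_1$ be absolutely continuous Borel probability measures on $\mathbb{R}^D$, with $\Pi(p_0,p_1)$ the set of their couplings. Define $$\mathrm{EOT}_\varepsilon(p_0,p_1)=\inf_{\pi\in\Pi(p_0,p_1)}\Big\{\mathbb{E}_{\pi}\big[\tfrac12\|x_0-x_1\|^2\big]-\varepsilon\int H\big(\pi(\cdot\mid x_0)\big)\,dp_0(x_0)\Big\}\in(-\infty,+\infty],$$ where $H(\rho)=-\int h\log h\,dx$ if $\rho$ has Lebesgue density $h$, $H(\rho)=-\infty$ if $\rho$ is not absolutely continuous, and the objective is $+\infty$ for couplings of infinite transport cost. For measurable $f:\mathbb{R}^D\to\mathbb{R}$ integrable with respect to $p_1$ and measurable $\xi:\mathbb{R}^D\to\mathbb{R}$ integrable with respect to $p_0$ put $$Z(f,x_0)=\int_{\mathbb{R}^D}\exp\Big(\frac{f(x_1)-\frac12\|x_0-x_1\|^2}{\varepsilon}\Big)dx_1\in(0,\infty],\qquad \mathcal L(f)=\mathbb{E}_{p_1}[f]-\varepsilon\,\mathbb{E}_{p_0}[\log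 Z(f,\cdot)],$$ $$\mathcal L(f,\xi)=\varepsilon\Big(1-\frac D2\log(2\pi\varepsilon)\Big)+\mathbb{E}_{p_1}[f]-\varepsilon\,\mathbb{E}_{p_0}[\xi]-\varepsilon\,\mathbb{E}_{x_0\sim p_0}\mathbb{E}_{z\sim\mathcal N(0,I)}\exp\Big(\frac{f(x_0+\sqrt\varepsilon z)}{\varepsilon}-\xi(x_0)\Big),$$ as extended real numbers ($\mathcal L(f)=-\infty$ if $\mathbb{E}_{p_0}[\log Z(f,\cdot)]$ is undefined). Then, in $[-\infty,\infty]$, $$\mathrm{EOT}_\varepsilon(p_0,p_1)=\sup_f\mathcal L(f)=\sup_{f,\xi}\mathcal L(f,\xi).$$ Suppose moreover that $\mathrm{EOT}_\varepsilon(p_0,p_1)<\infty$. Then the infimum is attained by a unique coupling $\pi^*$ (the EOT plan). If $f^*$ maximizes $\mathcal L(f)$ and $$\xi^*(x_0)=\log Z(f^*,x_0)-\tfrac D2\log(2\pi\varepsilon),$$ then $(f^*,\xi^*)$ maximizes $\mathcal L(f,\xi)$. Conversely, if $(f^*,\xi^*)$ maximizes $\mathcal L(f,\xi)$, then $f^*$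 maximizes $\mathcal L(f)$, $\xi^*$ is given by this formula $p_0$-almost everywhere, and for $p_0$-almost every $x_0$ the conditional distribution $\pi^*(\cdot\mid x_0)$ has the Lebesgue density $$\pi^*(x_1\mid x_0)=\frac{(2\pi\varepsilon)^{-D/2}}{\exp(\xi^*(x_0))}\exp\Big(\frac{f^*(x_1)-\frac12\|x_0-x_1\|^2}{\varepsilon}\Big).$$ (On $p_0$-null sets where $Z(f^*,\cdot)=\infty$, $\xi^*$ may be given any finite constant value.) -/

import Mathlib

open MeasureTheory ProbabilityTheory
open scoped ENNReal

noncomputable section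

namespace EntropicOT

/-- Euclidean space of dimension `D`. -/
abbrev E (D : ℕ) : Type := EuclideanSpace ℝ (Fin D)

/-- The integral of an extended-real-valued function: integral of the positive part minus integral
of the negative part. If both are infinite the integral is undefined and the value is `⊥`. -/
def extIntegral {α : Type*} [MeasurableSpace α] (μ : Measure α) (g : α → EReal) : EReal :=
  ((∫⁻ x, (g x).toENNReal ∂μ : ℝ≥0∞) : EReal) - ((∫⁻ x, (-g x).toENNReal ∂μ : ℝ≥0∞) : EReal)

/-- Differential entropy `H(ρ) = -∫ h log h dx`, where `h` is the Lebesgue density of `ρ`; it is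
`-∞` if `ρ` has no density. -/
def diffEntropy {D : ℕ} (ρ : Measure (E D)) : EReal :=
  open Classical in
  if ρ ≪ volume then
    extIntegral volume (fun x => ((Real.negMulLog (ρ.rnDeriv volume x).toReal : ℝ) : EReal))
  else ⊥

/-- The set `Π(p₀, p₁)` of transport plans. -/
def couplings {D : ℕ} (p₀ p₁ : Measure (E D)) : Set (ProbabilityMeasure (E D × E D)) :=
  {π | (π : Measure (E D × E D)).fst = p₀ ∧ (π : Measure (E D × E D)).snd = p₁}

/-- The transport cost `E_π[‖x₀ - x₁‖² / 2]`. -/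
def transportCost {D : ℕ} (π : ProbabilityMeasure (E D × E D)) : ℝ≥0∞ :=
  ∫⁻ x, ENNReal.ofReal (‖x.1 - x.2‖ ^ 2 / 2) ∂(π : Measure (E D × E D))

/-- The conditional distribution `π(· | x₀)` of a plan. -/
def conditional {D : ℕ} (π : ProbabilityMeasure (E D × E D)) (x₀ : E D) : Measure (E D) :=
  (π : Measure (E D × E D)).condKernel x₀

/-- The entropic transport objective `E_π[‖x₀ - x₁‖² / 2] - ε ∫ H(π(· | x₀)) dp₀(x₀)`; it is `+∞`
for plans of infinite transport cost. For plans of finite cost the entropy integral is well defined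
in `[-∞, ∞)`. -/
def eotObjective {D : ℕ} (ε : ℝ) (p₀ : Measure (E D)) (π : ProbabilityMeasure (E D × E D)) :
    EReal :=
  open Classical in
  if transportCost π = ∞ then ⊤
  else (transportCost π : EReal)
    - (ε : EReal) * extIntegral p₀ (fun x₀ => diffEntropy (conditional π x₀))

/-- The value `EOT_ε(p₀, p₁)`. -/
def eot {D : ℕ} (ε : ℝ) (p₀ p₁ : Measure (E D)) : EReal :=
  ⨅ π ∈ couplings p₀ p₁, eotObjective ε p₀ π

/-- `π` is an EOT plan: a coupling that attains the value `EOT_ε(p₀, p₁)`. -/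
def IsEOTPlan {D : ℕ} (ε : ℝ) (p₀ p₁ : Measure (E D)) (π : ProbabilityMeasure (E D × E D)) :
    Prop :=
  π ∈ couplings p₀ p₁ ∧ eotObjective ε p₀ π = eot ε p₀ p₁

/-- The admissible real-valued potentials: measurable functions integrable with respect to `p`. -/
def potentials {D : ℕ} (p : Measure (E D)) : Set (E D → ℝ) :=
  {f | Measurable f ∧ Integrable f p}

/-- The partition function `Z(f, x₀) = ∫ exp((f(x₁) - ‖x₀ - x₁‖² / 2) / ε) dx₁ ∈ [0, ∞]`. -/
def partition {D : ℕ} (ε : ℝ) (f : E D → ℝ) (x₀ : E D) : ℝ≥0∞ :=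
  ∫⁻ x₁, ENNReal.ofReal (Real.exp ((f x₁ - ‖x₀ - x₁‖ ^ 2 / 2) / ε))

/-- The weak dual objective `L(f) = E_{p₁}[f] - ε E_{p₀}[log Z(f, ·)]`, written as
`E_{p₁}[f] + ε E_{p₀}[-log Z(f, ·)]` so that it is `-∞` where the second expectation is
undefined. -/
def weakDual {D : ℕ} (ε : ℝ) (p₀ p₁ : Measure (E D)) (f : E D → ℝ) : EReal :=
  ((∫ x₁, f x₁ ∂p₁ : ℝ) : EReal)
    + (ε : EReal) * extIntegral p₀ (fun x₀ => -ENNReal.log (partition ε f x₀))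

/-- The variational objective
`L(f, ξ) = ε (1 - (D/2) log (2πε)) + E_{p₁}[f] - ε E_{p₀}[ξ]
  - ε E_{x₀ ∼ p₀} E_{z ∼ N(0, I)} exp(f(x₀ + √ε z)/ε - ξ(x₀))`. -/
def varDual {D : ℕ} (ε : ℝ) (p₀ p₁ : Measure (E D)) (f ξ : E D → ℝ) : EReal :=
  ((ε * (1 - (D : ℝ) / 2 * Real.log (2 * Real.pi * ε))
      + ∫ x₁, f x₁ ∂p₁ - ε * ∫ x₀, ξ x₀ ∂p₀ : ℝ) : EReal)
    - (ε : EReal) * ((∫⁻ x₀, ∫⁻ z, ENNReal.ofReal (Real.exp (f (x₀ + √ε • z) / ε - ξ x₀))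
        ∂(stdGaussian (E D)) ∂p₀ : ℝ≥0∞) : EReal)

/-- The shifted log-partition function `ξ*(x₀) = log Z(f, x₀) - (D/2) log (2πε)`. -/
def shiftedLogPartition {D : ℕ} (ε : ℝ) (f : E D → ℝ) (x₀ : E D) : ℝ :=
  Real.log (partition ε f x₀).toReal - (D : ℝ) / 2 * Real.log (2 * Real.pi * ε)

/-- `f` is an optimal solution of `sup_f L(f)`. -/
def IsWeakDualOptimal {D : ℕ} (ε : ℝ) (p₀ p₁ : Measure (E D)) (f : E D → ℝ) : Prop :=
  f ∈ potentials p₁ ∧ ∀ g ∈ potentials p₁, weakDual ε p₀ p₁ g ≤ weakDual ε p₀ p₁ f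

/-- `(f, ξ)` is an optimal solution of `sup_{f, ξ} L(f, ξ)`. -/
def IsVarDualOptimal {D : ℕ} (ε : ℝ) (p₀ p₁ : Measure (E D)) (f ξ : E D → ℝ) : Prop :=
  f ∈ potentials p₁ ∧ ξ ∈ potentials p₀ ∧
    ∀ g ∈ potentials p₁, ∀ ζ ∈ potentials p₀, varDual ε p₀ p₁ g ζ ≤ varDual ε p₀ p₁ f ξ

/-- The Gibbs conditional density
`(2πε)^{-D/2} / exp(ξ(x₀)) * exp((f(x₁) - ‖x₀ - x₁‖² / 2) / ε)`. -/
def gibbsDensity {D : ℕ} (ε : ℝ) (f ξ : E D → ℝ) (x₀ x₁ : E D) : ℝ :=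
  (2 * Real.pi * ε) ^ (-(D : ℝ) / 2) / Real.exp (ξ x₀)
    * Real.exp ((f x₁ - ‖x₀ - x₁‖ ^ 2 / 2) / ε)

end EntropicOT

end

/-!
After rescaling potentials by `ε`, the transport objective of a coupling `π` is
`ε * KL(π | R) - ε * (D / 2) * log (2πε)`, where `R = p₀ ⊗ N(x, ε I)` (`eotObjective_eq_klDiv`), so
the problem is the Schrödinger problem of minimizing the relative entropy to `R` over couplings.
Plans of infinite cost have infinite relative entropy, because the cost has an exponential moment
under `R` (`transportCost_ne_top`).

*Weak duality.* For a coupling `π` of finite relative entropy and a potential `f`, the gap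
`objective(π) - L(f)` equals `ε` times the `p₀`-mean of the relative entropy of `π(· | x)` with
respect to the Gibbs measure of `f` (`eotObjective_eq_weakDual_add`). In particular
`sup L ≤ EOT`, and a vanishing gap forces the conditionals of `π` to be Gibbs measures. Similarly
`L(f) - L(f, ξ)` is `ε` times the mean of `exp u - 1 - u`, with `u` the difference between the
shifted log-partition function and `ξ` (`weakDual_eq_varDual_add`); this gives
`L(f, ξ) ≤ L(f)` with equality only for the stated `ξ`.

*Strong duality.* Let `S` be the supremum of the dual functional
`J(f) = ∫ f dν - ∫ log ∫ exp f dκ_x dμ` over bounded measurable `f`; for such `f` the shifted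
log-partition function is bounded as well, so `S` is a lower bound for both dual values. If `S` is
finite, a coupling of relative entropy at most `S` is constructed (`exists_coupling_klDiv_le`).
At a midpoint, `J` exceeds the mean of its values by at least half the squared Hellinger distance of
the Gibbs measures (`dualValue_midpoint_ge`), so the Gibbs densities of a maximizing sequence are
Cauchy and converge in `L¹(R)`. Their first marginal is always `μ`; near-optimality in the
directions `t * 1_A` forces the second marginal of the limit to be `ν`. Finally, shrinking a
near-maximizer by a factor slightly below `1` makes the relative entropy of its Gibbs measure almost
at most `S` (`exists_gibbs_near_optimal`), and the relative entropy is lower semicontinuous by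
Fatou's lemma. No compactness or minimax theorem is needed.

Hence all the dual values and `EOT` coincide and, when finite, `EOT` is attained; the minimizer is
unique by strict convexity of the relative entropy.
-/

namespace EntropicOT

/-! ### Gibbs measures and the dual functional of the Schrödinger problem -/

section AbstractDuality

variable {X Y : Type*} [MeasurableSpace X] [MeasurableSpace Y]

/-- The class of bounded measurable functions, the test potentials of the abstract duality. -/
def IsBddMeasurable (f : Y → ℝ) : Prop :=
  Measurable f ∧ ∃ C, ∀ y, |f y| ≤ C

/-- The logarithmic partition function `log ∫ exp f dκ_x` of a potential `f` with respect to a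
reference kernel `κ`. -/
noncomputable def logMgf (κ : Kernel X Y) (f : Y → ℝ) (x : X) : ℝ :=
  Real.log (∫ y, Real.exp (f y) ∂κ x)

/-- The dual functional `∫ f dν - ∫ log ∫ exp f dκ_x dμ(x)` of the Schrödinger problem with
reference measure `μ ⊗ₘ κ`. -/
noncomputable def dualValue (μ : Measure X) (ν : Measure Y) (κ : Kernel X Y) (f : Y → ℝ) : ℝ :=
  ∫ y, f y ∂ν - ∫ x, logMgf κ f x ∂μ

/-- The density with respect to `κ_x` of the Gibbs measure of `f`, as a function of `(x, y)`. -/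
noncomputable def gibbs (κ : Kernel X Y) (f : Y → ℝ) (p : X × Y) : ℝ :=
  Real.exp (f p.2 - logMgf κ f p.1)

namespace IsBddMeasurable

variable {f g : Y → ℝ}

lemma const (c : ℝ) : IsBddMeasurable (fun _ : Y => c) :=
  ⟨measurable_const, |c|, fun _ => le_rfl⟩

lemma add (hf : IsBddMeasurable f) (hg : IsBddMeasurable g) :
    IsBddMeasurable (fun y => f y + g y) := by
  obtain ⟨hf, C, hC⟩ := hf
  obtain ⟨hg, C', hC'⟩ := hg
  exact ⟨hf.add hg, C + C', fun y => (abs_add_le _ _).trans (add_le_add (hC y) (hC' y))⟩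

lemma const_mul (hf : IsBddMeasurable f) (c : ℝ) : IsBddMeasurable (fun y => c * f y) := by
  obtain ⟨hf, C, hC⟩ := hf
  refine ⟨hf.const_mul c, |c| * C, fun y => ?_⟩
  rw [abs_mul]
  exact mul_le_mul_of_nonneg_left (hC y) (abs_nonneg c)

lemma mul (hf : IsBddMeasurable f) (hg : IsBddMeasurable g) :
    IsBddMeasurable (fun y => f y * g y) := by
  obtain ⟨hf, C, hC⟩ := hf
  obtain ⟨hg, C', hC'⟩ := hg
  refine ⟨hf.mul hg, C * C', fun y => ?_⟩
  rw [abs_mul]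
  exact mul_le_mul (hC y) (hC' y) (abs_nonneg _) ((abs_nonneg _).trans (hC y))

lemma sub (hf : IsBddMeasurable f) (hg : IsBddMeasurable g) :
    IsBddMeasurable (fun y => f y - g y) := by
  simpa [sub_eq_add_neg] using hf.add (hg.const_mul (-1))

lemma comp_continuous {φ : ℝ → ℝ} (hφ : Continuous φ) (hf : IsBddMeasurable f) :
    IsBddMeasurable (fun y => φ (f y)) := by
  obtain ⟨hf, C, hC⟩ := hf
  obtain ⟨B, hB⟩ := (isCompact_Icc (a := -C) (b := C)).exists_bound_of_continuousOn
    hφ.continuousOn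
  exact ⟨hφ.measurable.comp hf, B, fun y => hB _ (abs_le.1 (hC y))⟩

lemma exp (hf : IsBddMeasurable f) : IsBddMeasurable (fun y => Real.exp (f y)) :=
  hf.comp_continuous Real.continuous_exp

lemma comp_measurable {Z : Type*} [MeasurableSpace Z] {u : Z → Y} (hf : IsBddMeasurable f)
    (hu : Measurable u) : IsBddMeasurable (fun z => f (u z)) :=
  ⟨hf.1.comp hu, hf.2.imp fun _ hC z => hC (u z)⟩

lemma indicator {A : Set Y} (hA : MeasurableSet A) (hf : IsBddMeasurable f) :
    IsBddMeasurable (A.indicator f) := by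
  obtain ⟨hf, C, hC⟩ := hf
  refine ⟨hf.indicator hA, C, fun y => ?_⟩
  by_cases hy : y ∈ A
  · simpa [hy] using hC y
  · simpa [hy] using (abs_nonneg _).trans (hC y)

lemma integrable (hf : IsBddMeasurable f) (ρ : Measure Y) [IsFiniteMeasure ρ] :
    Integrable f ρ := by
  obtain ⟨hf, C, hC⟩ := hf
  exact Integrable.of_bound hf.aestronglyMeasurable C (ae_of_all _ hC)

lemma integral_kernel {h : X × Y → ℝ} (hh : IsBddMeasurable h) (κ : Kernel X Y)
    [IsMarkovKernel κ] : IsBddMeasurable (fun x => ∫ y, h (x, y) ∂κ x) := by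
  obtain ⟨hm, C, hC⟩ := hh
  refine ⟨(StronglyMeasurable.integral_kernel_prod_right' (κ := κ)
    hm.stronglyMeasurable).measurable, C, fun x => ?_⟩
  have := norm_integral_le_of_norm_le_const (μ := κ x) (f := fun y => h (x, y)) (C := C)
    (ae_of_all _ fun y => hC (x, y))
  simpa using this

end IsBddMeasurable

variable {κ : Kernel X Y} [IsMarkovKernel κ] {f g h : Y → ℝ}

lemma integral_exp_pos_kernel (hf : IsBddMeasurable f) (x : X) :
    0 < ∫ y, Real.exp (f y) ∂κ x :=
  integral_exp_pos (hf.exp.integrable _)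

lemma isBddMeasurable_logMgf (hf : IsBddMeasurable f) : IsBddMeasurable (logMgf κ f) := by
  refine ⟨Real.measurable_log.comp
    ((hf.exp.comp_measurable measurable_snd).integral_kernel κ).1, ?_⟩
  obtain ⟨hm, C, hC⟩ := hf
  refine ⟨C, fun x => ?_⟩
  have hpos := integral_exp_pos_kernel (κ := κ) ⟨hm, C, hC⟩ x
  have hint : Integrable (fun y => Real.exp (f y)) (κ x) :=
    IsBddMeasurable.integrable (IsBddMeasurable.exp ⟨hm, C, hC⟩) _
  rw [logMgf, abs_le]
  constructor
  · rw [Real.le_log_iff_exp_le hpos]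
    simpa using integral_mono (μ := κ x) (integrable_const (Real.exp (-C))) hint
      (fun y => Real.exp_le_exp.2 (abs_le.1 (hC y)).1)
  · rw [Real.log_le_iff_le_exp hpos]
    simpa using integral_mono (μ := κ x) hint (integrable_const (Real.exp C))
      (fun y => Real.exp_le_exp.2 (abs_le.1 (hC y)).2)

lemma isBddMeasurable_gibbs (hf : IsBddMeasurable f) : IsBddMeasurable (gibbs κ f) :=
  ((hf.comp_measurable measurable_snd).sub
    ((isBddMeasurable_logMgf hf).comp_measurable measurable_fst)).exp

lemma gibbs_pos (κ : Kernel X Y) (f : Y → ℝ) (p : X × Y) : 0 < gibbs κ f p := Real.exp_pos _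

lemma exp_logMgf (hf : IsBddMeasurable f) (x : X) :
    Real.exp (logMgf κ f x) = ∫ y, Real.exp (f y) ∂κ x :=
  Real.exp_log (integral_exp_pos_kernel hf x)

lemma integral_gibbs_kernel (hf : IsBddMeasurable f) (x : X) :
    ∫ y, gibbs κ f (x, y) ∂κ x = 1 := by
  simp only [gibbs, Real.exp_sub, integral_div, exp_logMgf hf x]
  exact div_self (integral_exp_pos_kernel hf x).ne'

/-- The linear upper bound `log t ≤ c + t * exp (-c) - 1` for the log-partition function. -/
lemma logMgf_le (hf : IsBddMeasurable f) (c : ℝ) (x : X) :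
    logMgf κ f x ≤ c + ∫ y, Real.exp (f y - c) ∂κ x - 1 := by
  have hpos := integral_exp_pos_kernel (κ := κ) hf x
  have h1 := Real.log_le_sub_one_of_pos (mul_pos hpos (Real.exp_pos (-c)))
  rw [Real.log_mul hpos.ne' (Real.exp_pos _).ne', Real.log_exp] at h1
  have h2 : ∫ y, Real.exp (f y - c) ∂κ x = (∫ y, Real.exp (f y) ∂κ x) * Real.exp (-c) := by
    simp only [sub_eq_add_neg, Real.exp_add, integral_mul_const]
  rw [h2, logMgf]
  linarith

/-- Convexity of the log-partition function, as the lower bound by its linearization at `f`. -/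
lemma logMgf_add_ge (hf : IsBddMeasurable f) (hh : IsBddMeasurable h) (x : X) :
    logMgf κ f x + ∫ y, h y * gibbs κ f (x, y) ∂κ x ≤ logMgf κ (fun y => f y + h y) x := by
  set c := ∫ y, h y * gibbs κ f (x, y) ∂κ x with hc
  have hgb : IsBddMeasurable (fun y => gibbs κ f (x, y)) :=
    (isBddMeasurable_gibbs hf).comp_measurable (by fun_prop)
  rw [logMgf, logMgf, ← logMgf, Real.le_log_iff_exp_le (integral_exp_pos_kernel (hf.add hh) x)]
  -- Jensen's inequality for the Gibbs measure, from `exp u ≥ exp c * (1 + u - c)`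
  have key : ∀ y, Real.exp (logMgf κ f x + c) * (gibbs κ f (x, y) + (h y * gibbs κ f (x, y)
      - c * gibbs κ f (x, y))) ≤ Real.exp (f y + h y) := by
    intro y
    have h1 : Real.exp (f y + h y)
        = Real.exp (logMgf κ f x + c) * (gibbs κ f (x, y) * Real.exp (h y - c)) := by
      simp only [gibbs, ← Real.exp_add]
      congr 1
      ring
    rw [h1]
    refine mul_le_mul_of_nonneg_left ?_ (Real.exp_pos _).le
    have h2 := mul_le_mul_of_nonneg_left (Real.add_one_le_exp (h y - c)) (gibbs_pos κ f (x, y)).le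
    linarith
  have i1 := hgb.integrable (κ x)
  have b2 := hh.mul hgb
  have i3 := (b2.sub (hgb.const_mul c)).integrable (κ x)
  have h3 := integral_mono ((i1.add i3).const_mul (Real.exp (logMgf κ f x + c)))
    ((hf.add hh).exp.integrable (κ x)) key
  refine le_trans (le_of_eq ?_) h3
  rw [integral_const_mul]
  simp only [Pi.add_apply]
  rw [integral_add i1 i3, integral_sub (b2.integrable _) (i1.const_mul c), integral_const_mul, integral_gibbs_kernel hf, ← hc]
  simp

variable {μ : Measure X} [IsProbabilityMeasure μ] {ν : Measure Y}

lemma integral_compProd_of_bdd {h : X × Y → ℝ} (hh : IsBddMeasurable h) :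
    ∫ p, h p ∂(μ ⊗ₘ κ) = ∫ x, ∫ y, h (x, y) ∂κ x ∂μ :=
  Measure.integral_compProd (hh.integrable _)

/-- The first marginal of the Gibbs measure of a potential is `μ`. -/
lemma integral_fst_mul_gibbs (hf : IsBddMeasurable f) {a : X → ℝ} (ha : IsBddMeasurable a) :
    ∫ p, a p.1 * gibbs κ f p ∂(μ ⊗ₘ κ) = ∫ x, a x ∂μ := by
  rw [integral_compProd_of_bdd ((ha.comp_measurable measurable_fst).mul (isBddMeasurable_gibbs hf))]
  simp only [integral_const_mul, integral_gibbs_kernel hf, mul_one]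

lemma integral_gibbs (hf : IsBddMeasurable f) : ∫ p, gibbs κ f p ∂(μ ⊗ₘ κ) = 1 := by
  simpa using integral_fst_mul_gibbs (κ := κ) (μ := μ) hf (IsBddMeasurable.const 1)

/-- The relative entropy of the Gibbs measure of `f` with respect to the reference measure. -/
lemma integral_klFun_gibbs (hf : IsBddMeasurable f) :
    ∫ p, InformationTheory.klFun (gibbs κ f p) ∂(μ ⊗ₘ κ)
      = dualValue μ ν κ f + ∫ p, f p.2 * gibbs κ f p ∂(μ ⊗ₘ κ) - ∫ y, f y ∂ν := by
  have bf := isBddMeasurable_logMgf (κ := κ) hf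
  have gf := isBddMeasurable_gibbs (κ := κ) hf
  have i1 := (hf.comp_measurable measurable_snd).mul gf
  have i2 := (bf.comp_measurable measurable_fst).mul gf
  have i3 := (IsBddMeasurable.const 1).sub gf
  have h1 : ∀ p, InformationTheory.klFun (gibbs κ f p)
      = f p.2 * gibbs κ f p - logMgf κ f p.1 * gibbs κ f p + (1 - gibbs κ f p) := by
    intro p
    rw [InformationTheory.klFun_apply]
    conv_lhs => rw [show Real.log (gibbs κ f p) = f p.2 - logMgf κ f p.1 from Real.log_exp _]
    ring
  simp only [h1]
  rw [integral_add ((i1.sub i2).integrable _) (i3.integrable _),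
    integral_sub (i1.integrable _) (i2.integrable _),
    integral_sub (integrable_const _) (gf.integrable _), integral_gibbs hf, integral_fst_mul_gibbs hf bf]
  simp only [dualValue, integral_const, probReal_univ, smul_eq_mul]
  ring

variable [IsProbabilityMeasure ν]

/-- Strong concavity of the dual functional: the defect of concavity at the midpoint controls the
squared Hellinger distance of the Gibbs measures. -/
lemma dualValue_midpoint_ge (hf : IsBddMeasurable f) (hg : IsBddMeasurable g) :
    dualValue μ ν κ f / 2 + dualValue μ ν κ g / 2
      + (∫ p, (√(gibbs κ f p) - √(gibbs κ g p)) ^ 2 ∂(μ ⊗ₘ κ)) / 2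
      ≤ dualValue μ ν κ (fun y => (1 / 2) * f y + (1 / 2) * g y) := by
  have hm := (hf.const_mul (1 / 2)).add (hg.const_mul (1 / 2))
  have bf := isBddMeasurable_logMgf (κ := κ) hf
  have bg := isBddMeasurable_logMgf (κ := κ) hg
  have gf := isBddMeasurable_gibbs (κ := κ) hf
  have gg := isBddMeasurable_gibbs (κ := κ) hg
  have hsq : IsBddMeasurable (fun p : X × Y => (√(gibbs κ f p) - √(gibbs κ g p)) ^ 2) :=
    ((gf.comp_continuous Real.continuous_sqrt).sub
      (gg.comp_continuous Real.continuous_sqrt)).comp_continuous (continuous_pow 2)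
  have key : ∀ x, logMgf κ (fun y => (1 / 2) * f y + (1 / 2) * g y) x
      ≤ (1 / 2) * logMgf κ f x + (1 / 2) * logMgf κ g x
        - (1 / 2) * ∫ y, (√(gibbs κ f (x, y)) - √(gibbs κ g (x, y))) ^ 2 ∂κ x := by
    intro x
    have h1 := logMgf_le (κ := κ) hm ((1 / 2) * logMgf κ f x + (1 / 2) * logMgf κ g x) x
    have hgf := gf.comp_measurable (u := fun y => (x, y)) (by fun_prop)
    have hgg := gg.comp_measurable (u := fun y => (x, y)) (by fun_prop)
    have hsqx : Integrable (fun y => (√(gibbs κ f (x, y)) - √(gibbs κ g (x, y))) ^ 2) (κ x) :=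
      (hsq.comp_measurable (u := fun y => (x, y)) (by fun_prop)).integrable _
    have h2 : ∫ y, Real.exp ((1 / 2) * f y + (1 / 2) * g y
          - ((1 / 2) * logMgf κ f x + (1 / 2) * logMgf κ g x)) ∂κ x
        = ∫ y, ((1 / 2) * (gibbs κ f (x, y) + gibbs κ g (x, y))
          - (1 / 2) * (√(gibbs κ f (x, y)) - √(gibbs κ g (x, y))) ^ 2) ∂κ x := by
      congr 1 with y
      have e1 := Real.sq_sqrt (gibbs_pos κ f (x, y)).le
      have e2 := Real.sq_sqrt (gibbs_pos κ g (x, y)).le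
      have e3 : Real.exp ((1 / 2) * f y + (1 / 2) * g y
          - ((1 / 2) * logMgf κ f x + (1 / 2) * logMgf κ g x))
          = √(gibbs κ f (x, y)) * √(gibbs κ g (x, y)) := by
        rw [gibbs, gibbs, Real.sqrt_eq_rpow, Real.sqrt_eq_rpow, ← Real.exp_mul, ← Real.exp_mul,
          ← Real.exp_add]
        congr 1
        ring
      rw [e3]
      nlinarith
    rw [h2, integral_sub (((hgf.add hgg).const_mul _).integrable _) (hsqx.const_mul _),
      integral_const_mul, integral_const_mul,
      integral_add (hgf.integrable _) (hgg.integrable _), integral_gibbs_kernel hf,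
      integral_gibbs_kernel hg] at h1
    linarith
  have h3 := integral_mono ((isBddMeasurable_logMgf (κ := κ) hm).integrable μ)
    ((((bf.const_mul (1 / 2)).add (bg.const_mul (1 / 2))).sub
      ((hsq.integral_kernel κ).const_mul (1 / 2))).integrable μ) key
  rw [integral_sub (((bf.const_mul (1 / 2)).add (bg.const_mul (1 / 2))).integrable μ)
      (((hsq.integral_kernel κ).const_mul (1 / 2)).integrable μ),
    integral_add ((bf.const_mul (1 / 2)).integrable μ) ((bg.const_mul (1 / 2)).integrable μ),
    integral_const_mul, integral_const_mul, integral_const_mul,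
    ← integral_compProd_of_bdd hsq] at h3
  simp only [dualValue]
  rw [integral_add ((hf.const_mul _).integrable ν) ((hg.const_mul _).integrable ν),
    integral_const_mul, integral_const_mul]
  linarith

/-- First-order lower bound for the dual functional in the direction `h`. -/
lemma dualValue_add_ge (hf : IsBddMeasurable f) (hh : IsBddMeasurable h) :
    dualValue μ ν κ f + ∫ y, h y ∂ν
        - ∫ p, (Real.exp (h p.2) - 1) * gibbs κ f p ∂(μ ⊗ₘ κ)
      ≤ dualValue μ ν κ (fun y => f y + h y) := by
  have bf := isBddMeasurable_logMgf (κ := κ) hf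
  have gf := isBddMeasurable_gibbs (κ := κ) hf
  have hb : IsBddMeasurable (fun p : X × Y => (Real.exp (h p.2) - 1) * gibbs κ f p) :=
    ((hh.exp.sub (IsBddMeasurable.const 1)).comp_measurable measurable_snd).mul gf
  have key : ∀ x, logMgf κ (fun y => f y + h y) x
      ≤ logMgf κ f x + ∫ y, (Real.exp (h y) - 1) * gibbs κ f (x, y) ∂κ x := by
    intro x
    have h1 := logMgf_le (κ := κ) (hf.add hh) (logMgf κ f x) x
    have i1 : Integrable (fun y => gibbs κ f (x, y)) (κ x) :=
      (gf.comp_measurable (u := fun y => (x, y)) (by fun_prop)).integrable _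
    have i2 : Integrable (fun y => (Real.exp (h y) - 1) * gibbs κ f (x, y)) (κ x) :=
      (hb.comp_measurable (u := fun y => (x, y)) (by fun_prop)).integrable _
    have h2 : ∫ y, Real.exp (f y + h y - logMgf κ f x) ∂κ x
        = ∫ y, ((Real.exp (h y) - 1) * gibbs κ f (x, y) + gibbs κ f (x, y)) ∂κ x := by
      congr 1 with y
      rw [show f y + h y - logMgf κ f x = h y + (f y - logMgf κ f x) by ring, Real.exp_add]
      simp only [gibbs]
      ring
    rw [h2, integral_add i2 i1, integral_gibbs_kernel hf] at h1
    linarith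
  have h3 := integral_mono ((isBddMeasurable_logMgf (κ := κ) (hf.add hh)).integrable μ)
    ((bf.add (hb.integral_kernel κ)).integrable μ) key
  rw [integral_add (bf.integrable μ) ((hb.integral_kernel κ).integrable μ),
    ← integral_compProd_of_bdd hb] at h3
  simp only [dualValue]
  rw [integral_add (hf.integrable ν) (hh.integrable ν)]
  linarith

/-- First-order upper bound (concavity) for the dual functional in the direction `h`. -/
lemma dualValue_add_le (hf : IsBddMeasurable f) (hh : IsBddMeasurable h) :
    dualValue μ ν κ (fun y => f y + h y)
      ≤ dualValue μ ν κ f + ∫ y, h y ∂ν - ∫ p, h p.2 * gibbs κ f p ∂(μ ⊗ₘ κ) := by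
  have bf := isBddMeasurable_logMgf (κ := κ) hf
  have hb : IsBddMeasurable (fun p : X × Y => h p.2 * gibbs κ f p) :=
    (hh.comp_measurable measurable_snd).mul (isBddMeasurable_gibbs (κ := κ) hf)
  have h3 := integral_mono ((bf.add (hb.integral_kernel κ)).integrable μ)
    ((isBddMeasurable_logMgf (κ := κ) (hf.add hh)).integrable μ) (logMgf_add_ge hf hh)
  rw [integral_add (bf.integrable μ) ((hb.integral_kernel κ).integrable μ),
    ← integral_compProd_of_bdd hb] at h3
  simp only [dualValue]
  rw [integral_add (hf.integrable ν) (hh.integrable ν)]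
  linarith

/-- Near-maximizers of the dual functional can be chosen with Gibbs measures of relative entropy
almost at most the dual value: this follows from shrinking a near-maximizer slightly. -/
lemma exists_gibbs_near_optimal {S : ℝ}
    (hS : IsLUB {r | ∃ f, IsBddMeasurable f ∧ dualValue μ ν κ f = r} S) {η : ℝ} (hη : 0 < η) :
    ∃ f, IsBddMeasurable f ∧ S - η ≤ dualValue μ ν κ f ∧
      ∫ p, InformationTheory.klFun (gibbs κ f p) ∂(μ ⊗ₘ κ) ≤ S + η := by
  have h0 : dualValue μ ν κ (fun _ => (0 : ℝ)) = 0 := by simp [dualValue, logMgf]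
  have hS0 : 0 ≤ S := hS.1 ⟨_, IsBddMeasurable.const 0, h0⟩
  -- the shrinking factor is `1 - s`
  set s : ℝ := min (1 / 2) (η / (2 * (S + 1))) with hs
  have hs0 : 0 < s := by positivity
  have hs1 : s ≤ 1 / 2 := min_le_left _ _
  have hs2 : s * S ≤ η / 2 := by
    have h1 : s ≤ η / (2 * (S + 1)) := min_le_right _ _
    rw [le_div_iff₀ (by positivity)] at h1
    nlinarith
  set δ : ℝ := s * η / 2 with hδ
  have hδ0 : 0 < δ := by positivity
  obtain ⟨_, ⟨f, hf, rfl⟩, hfS, -⟩ := hS.exists_between (sub_lt_self S hδ0)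
  have hF := hf.const_mul (1 - s)
  set I : ℝ := ∫ p, f p.2 * gibbs κ (fun y => (1 - s) * f y) p ∂(μ ⊗ₘ κ) with hI
  set K : ℝ := ∫ y, f y ∂ν with hK
  have hFS : dualValue μ ν κ (fun y => (1 - s) * f y) ≤ S := hS.1 ⟨_, hF, rfl⟩
  have up1 := dualValue_add_le (μ := μ) (ν := ν) (κ := κ) hF (hf.const_mul s)
  have up2 := dualValue_add_le (μ := μ) (ν := ν) (κ := κ) hF (hf.const_mul (-(1 - s)))
  have e1 : (fun y => (1 - s) * f y + s * f y) = f := by ext y; ring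
  have e2 : (fun y => (1 - s) * f y + -(1 - s) * f y) = fun _ => (0 : ℝ) := by ext y; ring
  rw [e1] at up1
  rw [e2, h0] at up2
  simp only [mul_assoc, integral_const_mul] at up1 up2
  rw [← hI, ← hK] at up1 up2
  refine ⟨_, hF, ?_, ?_⟩
  · nlinarith
  · rw [integral_klFun_gibbs (ν := ν) hF]
    simp only [mul_assoc, integral_const_mul]
    rw [← hI, ← hK]
    have h5 : s * (I - K) ≤ s * (η / 2) := by nlinarith
    have h6 : I - K ≤ η / 2 := le_of_mul_le_mul_left h5 hs0
    nlinarith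

end AbstractDuality

/-! ### Convergence of maximizing sequences -/

section Existence

open Filter Topology

/-- A sequence of probability densities that is Cauchy in the Hellinger distance converges in
`L¹`, and along a subsequence almost everywhere. -/
lemma exists_limit_of_hellinger_cauchy {Z : Type*} [MeasurableSpace Z] {ρ : Measure Z}
    [IsProbabilityMeasure ρ] {G : ℕ → Z → ℝ} (hG : ∀ n, IsBddMeasurable (G n))
    (hpos : ∀ n z, 0 ≤ G n z) (h1 : ∀ n, ∫ z, G n z ∂ρ = 1) {η : ℕ → ℝ}
    (hη : Tendsto η atTop (𝓝 0))
    (hH : ∀ n m, ∫ z, (√(G n z) - √(G m z)) ^ 2 ∂ρ ≤ η n + η m) :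
    ∃ g : Z → ℝ, Measurable g ∧ Integrable g ρ ∧ (∀ z, 0 ≤ g z) ∧
      (∀ s, Tendsto (fun n => ∫ z in s, G n z ∂ρ) atTop (𝓝 (∫ z in s, g z ∂ρ))) ∧
      ∃ ns : ℕ → ℕ, StrictMono ns ∧ ∀ᵐ z ∂ρ, Tendsto (fun i => G (ns i) z) atTop (𝓝 (g z)) := by
  have hi : ∀ n, Integrable (G n) ρ := fun n => (hG n).integrable ρ
  have hdist : ∀ n m, ∀ t > 0, ∫ z, |G n z - G m z| ∂ρ ≤ (η n + η m) / (2 * t) + 2 * t := by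
    intro n m t ht
    have hsq : IsBddMeasurable (fun z => (√(G n z) - √(G m z)) ^ 2) :=
      (((hG n).comp_continuous Real.continuous_sqrt).sub
        ((hG m).comp_continuous Real.continuous_sqrt)).comp_continuous (continuous_pow 2)
    have hpt : ∀ z, |G n z - G m z| ≤ (2 * t)⁻¹ * (√(G n z) - √(G m z)) ^ 2
        + t * (G n z + G m z) := by
      intro z
      have e1 := Real.sq_sqrt (hpos n z)
      have e2 := Real.sq_sqrt (hpos m z)
      set a := √(G n z)
      set b := √(G m z)
      have ha : 0 ≤ a := Real.sqrt_nonneg _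
      have hb : 0 ≤ b := Real.sqrt_nonneg _
      have h3 : |G n z - G m z| = |a - b| * (a + b) := by
        rw [← e1, ← e2, show a ^ 2 - b ^ 2 = (a - b) * (a + b) by ring, abs_mul,
          abs_of_nonneg (add_nonneg ha hb)]
      rw [h3, ← e1, ← e2, ← sq_abs (a - b), inv_mul_eq_div, ← sub_le_iff_le_add,
        le_div_iff₀ (by positivity)]
      nlinarith [sq_nonneg (|a - b| - t * (a + b)), sq_nonneg (a - b), sq_nonneg (t * (a - b))]
    have h4 := integral_mono (((hG n).sub (hG m)).comp_continuous continuous_abs |>.integrable ρ)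
      (((hsq.const_mul (2 * t)⁻¹).add (((hG n).add (hG m)).const_mul t)).integrable ρ) hpt
    rw [integral_add ((hsq.const_mul _).integrable ρ)
      ((((hG n).add (hG m)).const_mul t).integrable ρ), integral_const_mul, integral_const_mul,
      integral_add (hi n) (hi m), h1, h1, inv_mul_eq_div] at h4
    refine h4.trans ?_
    have := div_le_div_of_nonneg_right (hH n m) (by positivity : 0 ≤ 2 * t)
    linarith
  have hdist' : ∀ n m, dist ((hi n).toL1 (G n)) ((hi m).toL1 (G m)) = ∫ z, |G n z - G m z| ∂ρ := by
    intro n m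
    rw [dist_eq_norm, ← Integrable.toL1_sub, L1.norm_of_fun_eq_integral_norm]
    rfl
  have hcau : CauchySeq (fun n => (hi n).toL1 (G n)) := by
    refine Metric.cauchySeq_iff.2 fun e he => ?_
    have he' : 0 < e ^ 2 / 16 := by positivity
    obtain ⟨N, hN⟩ := eventually_atTop.1 (hη.eventually_lt_const he')
    refine ⟨N, fun n hn m hm => ?_⟩
    rw [hdist']
    refine (hdist n m (e / 4) (by positivity)).trans_lt ?_
    have h5 : (η n + η m) / (2 * (e / 4)) < e / 2 := by
      rw [div_lt_iff₀ (by positivity)]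
      nlinarith [hN n hn, hN m hm]
    linarith
  obtain ⟨g₀, hg₀⟩ := cauchySeq_tendsto_of_complete hcau
  obtain ⟨ns, hns, hae⟩ := (tendstoInMeasure_of_tendsto_Lp hg₀).exists_seq_tendsto_ae
  have hae' : ∀ᵐ z ∂ρ, Tendsto (fun i => G (ns i) z) atTop (𝓝 (g₀ z)) := by
    have : ∀ᵐ z ∂ρ, ∀ n, (hi n).toL1 (G n) z = G n z :=
      ae_all_iff.2 fun n => (hi n).coeFn_toL1
    filter_upwards [hae, this] with z hz hz'
    simpa only [hz'] using hz
  obtain ⟨g₁, hg₁m, hg₁⟩ := (Lp.aestronglyMeasurable g₀)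
  have hg : (fun z => max (g₁ z) 0) =ᵐ[ρ] g₀ := by
    filter_upwards [hae', hg₁] with z hz hz'
    rw [← hz', max_eq_left (ge_of_tendsto' hz fun i => hpos _ z)]
  have hgi : Integrable (fun z => max (g₁ z) 0) ρ := (L1.integrable_coeFn g₀).congr hg.symm
  refine ⟨_, hg₁m.measurable.max measurable_const, hgi, fun z => le_max_right _ _, fun s => ?_,
    ns, hns, ?_⟩
  · refine tendsto_setIntegral_of_L1' _ hgi.aestronglyMeasurable (Eventually.of_forall hi) ?_ s
    have h6 := (tendsto_iff_edist_tendsto_0.1 hg₀)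
    refine h6.congr fun n => ?_
    rw [Lp.edist_def]
    refine eLpNorm_congr_ae ?_
    filter_upwards [(hi n).coeFn_toL1, hg] with z hz hz'
    simp only [Pi.sub_apply, hz, hz']
  · filter_upwards [hae', hg] with z hz hz'
    simpa only [hz'] using hz

variable {X Y : Type*} [MeasurableSpace X] [MeasurableSpace Y] {κ : Kernel X Y} [IsMarkovKernel κ]
  {μ : Measure X} [IsProbabilityMeasure μ] {ν : Measure Y} [IsProbabilityMeasure ν]

/-- A measure with marginals `μ` and `ν` and relative entropy at most `S` with respect to
`μ ⊗ₘ κ` exists as soon as `S` is the supremum of the dual functional over bounded potentials: it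
is the limit of the Gibbs measures of a maximizing sequence. -/
theorem exists_coupling_klDiv_le {S : ℝ}
    (hS : IsLUB {r | ∃ f, IsBddMeasurable f ∧ dualValue μ ν κ f = r} S) :
    ∃ π : Measure (X × Y), IsProbabilityMeasure π ∧ π.fst = μ ∧ π.snd = ν ∧
      InformationTheory.klDiv π (μ ⊗ₘ κ) ≤ ENNReal.ofReal S := by
  have hηpos : ∀ n : ℕ, (0 : ℝ) < 1 / ((n : ℝ) + 1) := fun n => by positivity
  have hη : Tendsto (fun n : ℕ => 1 / ((n : ℝ) + 1)) atTop (𝓝 0) :=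
    tendsto_one_div_add_atTop_nhds_zero_nat
  choose f hf hfS hfK using fun n => exists_gibbs_near_optimal hS (hηpos n)
  have hG : ∀ n, IsBddMeasurable (gibbs κ (f n)) := fun n => isBddMeasurable_gibbs (hf n)
  obtain ⟨g, hgm, hgi, hg0, hset, ns, hns, hae⟩ := exists_limit_of_hellinger_cauchy
    (ρ := μ ⊗ₘ κ) hG (fun n z => (gibbs_pos κ _ z).le) (fun n => integral_gibbs (hf n)) hη
    (fun n m => by
      have h1 := dualValue_midpoint_ge (μ := μ) (ν := ν) (κ := κ) (hf n) (hf m)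
      have h2 := hS.1 ⟨_, ((hf n).const_mul (1 / 2)).add ((hf m).const_mul (1 / 2)), rfl⟩
      have h3 := hfS n
      have h4 := hfS m
      linarith)
  set π : Measure (X × Y) := (μ ⊗ₘ κ).withDensity (fun p => ENNReal.ofReal (g p)) with hπ
  have hπs : ∀ s, MeasurableSet s → π s = ENNReal.ofReal (∫ p in s, g p ∂(μ ⊗ₘ κ)) := by
    intro s hs
    rw [hπ, withDensity_apply _ hs, ofReal_integral_eq_lintegral_ofReal hgi.integrableOn
      (ae_of_all _ hg0)]
  have hfst : π.fst = μ := by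
    ext A hA
    rw [Measure.fst_apply hA, hπs _ (measurable_fst hA)]
    have h1 : ∀ n, ∫ p in Prod.fst ⁻¹' A, gibbs κ (f n) p ∂(μ ⊗ₘ κ) = μ.real A := by
      intro n
      have h2 := integral_fst_mul_gibbs (κ := κ) (μ := μ) (hf n)
        ((IsBddMeasurable.const (1 : ℝ)).indicator hA)
      rw [integral_indicator hA] at h2
      simp only [integral_const, smul_eq_mul, mul_one, measureReal_restrict_apply_univ] at h2
      rw [← h2, ← integral_indicator (measurable_fst hA)]
      congr 1 with p
      by_cases hp : p.1 ∈ A <;> simp [Set.indicator, hp]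
    have h3 := hset (Prod.fst ⁻¹' A)
    simp only [h1] at h3
    rw [tendsto_nhds_unique h3 tendsto_const_nhds, ofReal_measureReal]
  have hprob : IsProbabilityMeasure π := by
    constructor
    rw [← Measure.fst_univ, hfst, measure_univ]
  have hsnd : π.snd = ν := by
    refine (Measure.eq_of_le_of_isProbabilityMeasure (Measure.le_iff.2 fun A hA => ?_)).symm
    rw [Measure.snd_apply hA, hπs _ (measurable_snd hA), ← ofReal_measureReal]
    refine ENNReal.ofReal_le_ofReal ?_
    set b := ∫ p in Prod.snd ⁻¹' A, g p ∂(μ ⊗ₘ κ) with hb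
    have hb0 : 0 ≤ b := integral_nonneg hg0
    -- stationarity of the limit in the direction `t * 1_A`
    have key : ∀ t : ℝ, t * ν.real A ≤ (Real.exp t - 1) * b := by
      intro t
      have hA' : IsBddMeasurable (A.indicator fun _ => t) :=
        (IsBddMeasurable.const t).indicator hA
      have h1 : ∀ n : ℕ, -(1 / ((n : ℝ) + 1)) + t * ν.real A
          ≤ (Real.exp t - 1) * ∫ p in Prod.snd ⁻¹' A, gibbs κ (f n) p ∂(μ ⊗ₘ κ) := by
        intro n
        have h2 := dualValue_add_ge (μ := μ) (ν := ν) (κ := κ) (hf n) hA'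
        have h3 := hS.1 ⟨_, (hf n).add hA', rfl⟩
        have h4 := hfS n
        have h5 : ∫ p, (Real.exp (A.indicator (fun _ => t) p.2) - 1) * gibbs κ (f n) p ∂(μ ⊗ₘ κ)
            = (Real.exp t - 1) * ∫ p in Prod.snd ⁻¹' A, gibbs κ (f n) p ∂(μ ⊗ₘ κ) := by
          rw [← integral_const_mul, ← integral_indicator (measurable_snd hA)]
          congr 1 with p
          by_cases hp : p.2 ∈ A <;> simp [Set.indicator, hp]
        rw [h5, integral_indicator hA] at h2
        simp only [integral_const, smul_eq_mul, measureReal_restrict_apply_univ] at h2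
        linarith
      refine le_of_tendsto_of_tendsto' ?_ ((hset (Prod.snd ⁻¹' A)).const_mul _) h1
      simpa using (hη.neg.add_const (t * ν.real A))
    refine le_of_forall_pos_le_add fun e he => ?_
    -- divide by a small `t` and use `exp t - 1 ≤ t + t ^ 2`
    set t := min 1 (e / (b + 1)) with ht
    have ht0 : 0 < t := by positivity
    have ht1 : t ≤ 1 := min_le_left _ _
    have htb : t * b ≤ e := by
      have h6 : t ≤ e / (b + 1) := min_le_right _ _
      rw [le_div_iff₀ (by positivity)] at h6
      nlinarith
    have h7 := (abs_le.1 (Real.abs_exp_sub_one_sub_id_le (x := t)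
      (by rw [abs_of_pos ht0]; exact ht1))).2
    have h8 : t * ν.real A ≤ t * (b + e) := by
      refine (key t).trans ?_
      have h9 : (Real.exp t - 1) * b ≤ (t + t ^ 2) * b :=
        mul_le_mul_of_nonneg_right (by linarith) hb0
      nlinarith
    exact le_of_mul_le_mul_left h8 ht0
  refine ⟨π, hprob, hfst, hsnd, ?_⟩
  rw [InformationTheory.klDiv_eq_lintegral_klFun_of_ac (withDensity_absolutelyContinuous _ _)]
  have h1 : ∀ᵐ p ∂(μ ⊗ₘ κ), ENNReal.ofReal (InformationTheory.klFun (π.rnDeriv (μ ⊗ₘ κ) p).toReal)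
      = liminf (fun i => ENNReal.ofReal (InformationTheory.klFun (gibbs κ (f (ns i)) p))) atTop := by
    filter_upwards [Measure.rnDeriv_withDensity (μ ⊗ₘ κ) hgm.ennreal_ofReal, hae] with p hp hp'
    rw [hp, ENNReal.toReal_ofReal (hg0 p)]
    exact ((ENNReal.continuous_ofReal.comp
      InformationTheory.continuous_klFun).tendsto (g p) |>.comp hp').liminf_eq.symm
  rw [lintegral_congr_ae h1]
  refine (lintegral_liminf_le fun i => (InformationTheory.measurable_klFun.comp
    (hG (ns i)).1).ennreal_ofReal).trans ?_
  have h2 : ∀ i, ∫⁻ p, ENNReal.ofReal (InformationTheory.klFun (gibbs κ (f (ns i)) p)) ∂(μ ⊗ₘ κ)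
      ≤ ENNReal.ofReal (S + 1 / ((ns i : ℝ) + 1)) := by
    intro i
    rw [← ofReal_integral_eq_lintegral_ofReal
      (((hG (ns i)).comp_continuous InformationTheory.continuous_klFun).integrable _)
      (ae_of_all _ fun p => InformationTheory.klFun_nonneg (gibbs_pos κ _ p).le)]
    exact ENNReal.ofReal_le_ofReal (hfK _)
  have h3 : Tendsto (fun i => ENNReal.ofReal (S + 1 / ((ns i : ℝ) + 1))) atTop
      (𝓝 (ENNReal.ofReal S)) := by
    refine (ENNReal.continuous_ofReal.tendsto S).comp ?_
    simpa using (hη.comp hns.tendsto_atTop).const_add S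
  rw [← h3.liminf_eq]
  exact liminf_le_liminf (Eventually.of_forall h2)

end Existence

/-! ### Extended-real integrals -/

section ExtendedIntegral

variable {α : Type*} [MeasurableSpace α] {μ : Measure α}

lemma extIntegral_congr_ae {g h : α → EReal} (hgh : g =ᵐ[μ] h) :
    extIntegral μ g = extIntegral μ h := by
  unfold extIntegral
  congr 2
  · exact lintegral_congr_ae (hgh.mono fun x hx => by simp only [hx])
  · exact lintegral_congr_ae (hgh.mono fun x hx => by simp only [hx])

/-- The integral of the difference of an integrable function and a nonnegative function. -/
lemma extIntegral_sub {a : α → ℝ} (ha : Integrable a μ) {k : α → ℝ≥0∞} (hk : AEMeasurable k μ) :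
    extIntegral μ (fun x => (a x : EReal) - (k x : EReal))
      = ((∫ x, a x ∂μ : ℝ) : EReal) - ((∫⁻ x, k x ∂μ : ℝ≥0∞) : EReal) := by
  -- `P` and `N` are the positive and the negative part of the integrand
  set P : α → ℝ≥0∞ := fun x => ((a x : EReal) - (k x : EReal)).toENNReal with hP
  set N : α → ℝ≥0∞ := fun x => (-((a x : EReal) - (k x : EReal))).toENNReal with hN
  have hpt : ∀ x, P x + ENNReal.ofReal (-a x) + k x = N x + ENNReal.ofReal (a x) := by
    intro x
    simp only [hP, hN]
    rcases eq_or_ne (k x) ⊤ with h | h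
    · simp [h]
    · lift k x to NNReal using h with r
      have e1 : ((r : ℝ≥0∞) : EReal) = ((r : ℝ) : EReal) := rfl
      have e2 : (r : ℝ≥0∞) = ENNReal.ofReal r := by simp
      rw [e1, e2, ← EReal.coe_sub, ← EReal.coe_neg, EReal.real_coe_toENNReal,
        EReal.real_coe_toENNReal]
      have hr := r.2
      rcases le_total (a x) 0 with h0 | h0
      · rw [ENNReal.ofReal_of_nonpos (by linarith : a x - (r : ℝ) ≤ 0), ENNReal.ofReal_of_nonpos h0,
          zero_add, add_zero, ← ENNReal.ofReal_add (by linarith) (by linarith)]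
        congr 1
        ring
      · rcases le_total (a x) r with h1 | h1
        · rw [ENNReal.ofReal_of_nonpos (by linarith : a x - (r : ℝ) ≤ 0),
            ENNReal.ofReal_of_nonpos (by linarith : -a x ≤ 0),
            ← ENNReal.ofReal_add (by linarith) (by linarith)]
          simp
        · rw [ENNReal.ofReal_of_nonpos (by linarith : -(a x - (r : ℝ)) ≤ 0),
            ENNReal.ofReal_of_nonpos (by linarith : -a x ≤ 0), add_zero,
            ← ENNReal.ofReal_add (by linarith) (by linarith)]
          simp
  have hint : ∫⁻ x, P x ∂μ + ∫⁻ x, ENNReal.ofReal (-a x) ∂μ + ∫⁻ x, k x ∂μ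
      = ∫⁻ x, N x ∂μ + ∫⁻ x, ENNReal.ofReal (a x) ∂μ := by
    have ham : AEMeasurable (fun x => ENNReal.ofReal (-a x)) μ :=
      ha.aemeasurable.neg.ennreal_ofReal
    rw [← lintegral_add_right' _ ham, ← lintegral_add_right' _ hk,
      ← lintegral_add_right' _ ha.aemeasurable.ennreal_ofReal]
    exact lintegral_congr hpt
  have hfp : ∫⁻ x, ENNReal.ofReal (a x) ∂μ ≠ ⊤ := 
    ((lintegral_ofReal_le_lintegral_enorm _).trans_lt ha.2).ne
  have hfn : ∫⁻ x, ENNReal.ofReal (-a x) ∂μ ≠ ⊤ := 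
    ((lintegral_ofReal_le_lintegral_enorm _).trans_lt ha.neg.2).ne
  have hPle : ∫⁻ x, P x ∂μ ≤ ∫⁻ x, ENNReal.ofReal (a x) ∂μ := by
    refine lintegral_mono fun x => ?_
    simp only [hP]
    rw [← EReal.real_coe_toENNReal]
    refine EReal.toENNReal_le_toENNReal ?_
    rw [sub_eq_add_neg]
    calc (a x : EReal) + -(k x : EReal) ≤ (a x : EReal) + 0 := by
          gcongr
          simpa using EReal.coe_ennreal_nonneg (k x)
      _ = a x := add_zero _
  have hPf : ∫⁻ x, P x ∂μ ≠ ⊤ := ne_top_of_le_ne_top hfp hPle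
  rw [integral_eq_lintegral_pos_part_sub_lintegral_neg_part ha]
  change ((∫⁻ x, P x ∂μ : ℝ≥0∞) : EReal) - ((∫⁻ x, N x ∂μ : ℝ≥0∞) : EReal) = _
  generalize ∫⁻ x, P x ∂μ = p at *
  generalize ∫⁻ x, N x ∂μ = n at *
  generalize ∫⁻ x, ENNReal.ofReal (a x) ∂μ = ap at *
  generalize ∫⁻ x, ENNReal.ofReal (-a x) ∂μ = an at *
  generalize ∫⁻ x, k x ∂μ = K at *
  lift p to NNReal using hPf
  lift ap to NNReal using hfp
  lift an to NNReal using hfn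
  rcases eq_or_ne K ⊤ with h | h
  · subst h
    have hn : n = ⊤ := by
      rcases eq_or_ne n ⊤ with h | h
      · exact h
      · lift n to NNReal using h
        simp at hint
        exact absurd hint.symm (by exact_mod_cast ENNReal.coe_ne_top)
    simp [hn]
  · have hn : n ≠ ⊤ := by
      rintro rfl
      lift K to NNReal using h
      simp at hint
    lift K to NNReal using h
    lift n to NNReal using hn
    have e1 : ∀ r : NNReal, ((r : ℝ≥0∞) : EReal) = ((r : ℝ) : EReal) := fun r => rfl
    simp only [e1, ← EReal.coe_sub, ENNReal.coe_toReal]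
    have h2 : (p : ℝ) + an + K = n + ap := by exact_mod_cast hint
    congr 1
    linarith

/-- The integral of the sum of an integrable function and a nonnegative function. -/
lemma extIntegral_add {a : α → ℝ} (ha : Integrable a μ) {k : α → ℝ≥0∞} (hk : AEMeasurable k μ) :
    extIntegral μ (fun x => (a x : EReal) + (k x : EReal))
      = ((∫ x, a x ∂μ : ℝ) : EReal) + ((∫⁻ x, k x ∂μ : ℝ≥0∞) : EReal) := by
  have h1 := extIntegral_sub ha.neg hk
  have hneg : ∀ x, -((-a) x - (k x : EReal) : EReal) = (a x : EReal) + (k x : EReal) := by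
    intro x
    rw [EReal.neg_sub (Or.inl (EReal.coe_ne_bot _)) (Or.inl (EReal.coe_ne_top _))]
    simp
  have hneg' : ∀ x, (((-a) x : ℝ) : EReal) - (k x : EReal) = -((a x : EReal) + (k x : EReal)) := by
    intro x
    rw [← hneg x, neg_neg]
  -- the negative part of the sum has a finite integral, so the integral changes sign
  have hfin : ∫⁻ x, (-((a x : EReal) + (k x : EReal))).toENNReal ∂μ ≠ ⊤ := by
    refine ne_top_of_le_ne_top ((lintegral_ofReal_le_lintegral_enorm _).trans_lt ha.neg.2).ne
      (lintegral_mono fun x => ?_)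
    rw [← EReal.real_coe_toENNReal]
    refine EReal.toENNReal_le_toENNReal ?_
    simp only [Pi.neg_apply, EReal.coe_neg, EReal.neg_le_neg_iff]
    calc (a x : EReal) = a x + 0 := (add_zero _).symm
      _ ≤ _ := by
        gcongr
        exact EReal.coe_ennreal_nonneg (k x)
  simp only [hneg'] at h1
  simp only [extIntegral, neg_neg] at h1 ⊢
  rw [← neg_inj, EReal.neg_sub (Or.inr (EReal.coe_ennreal_ne_bot _))
    (Or.inr (EReal.coe_ennreal_eq_top_iff.not.2 hfin)), add_comm, ← sub_eq_add_neg, h1,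
    EReal.neg_add (Or.inl (EReal.coe_ne_bot _)) (Or.inl (EReal.coe_ne_top _))]
  simp [integral_neg]

lemma extIntegral_coe {a : α → ℝ} (ha : Integrable a μ) :
    extIntegral μ (fun x => (a x : EReal)) = ((∫ x, a x ∂μ : ℝ) : EReal) := by
  simpa using extIntegral_sub ha (k := fun _ => 0) measurable_const.aemeasurable

/-- A measurable function with real integral is almost everywhere real and integrable. -/
lemma integrable_toReal_of_extIntegral_ne {g : α → EReal} (hg : Measurable g)
    (h1 : extIntegral μ g ≠ ⊥) (h2 : extIntegral μ g ≠ ⊤) :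
    (∀ᵐ x ∂μ, g x ≠ ⊥ ∧ g x ≠ ⊤) ∧ Integrable (fun x => (g x).toReal) μ := by
  have hn : ∫⁻ x, (-g x).toENNReal ∂μ ≠ ⊤ := by
    intro h
    rw [extIntegral, h] at h1
    simp at h1
  have hp : ∫⁻ x, (g x).toENNReal ∂μ ≠ ⊤ := by
    intro h
    lift ∫⁻ x, (-g x).toENNReal ∂μ to NNReal using hn with r hr
    rw [extIntegral, h, ← hr] at h2
    exact h2 (EReal.top_sub_coe r)
  have hgp : Measurable fun x => (g x).toENNReal := hg.ereal_toENNReal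
  have hgn : Measurable fun x => (-g x).toENNReal := hg.neg.ereal_toENNReal
  have hae : ∀ᵐ x ∂μ, g x ≠ ⊥ ∧ g x ≠ ⊤ := by
    filter_upwards [ae_lt_top hgp hp, ae_lt_top hgn hn] with x hx hx'
    refine ⟨fun h => ?_, fun h => ?_⟩
    · rw [h] at hx'; simp at hx'
    · rw [h] at hx; simp at hx
  refine ⟨hae, hg.ereal_toReal.aestronglyMeasurable, ?_⟩
  refine lt_of_le_of_lt (b := ∫⁻ x, ((g x).toENNReal + (-g x).toENNReal) ∂μ)
    (lintegral_mono_ae ?_) ?_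
  · filter_upwards [hae] with x hx
    obtain ⟨r, hr⟩ : ∃ r : ℝ, g x = r := ⟨_, (EReal.coe_toReal hx.2 hx.1).symm⟩
    rw [hr, ← EReal.coe_neg, EReal.real_coe_toENNReal, EReal.real_coe_toENNReal, EReal.toReal_coe,
      ← ofReal_norm, Real.norm_eq_abs]
    rcases le_total 0 r with h | h
    · rw [abs_of_nonneg h]; exact le_self_add
    · rw [abs_of_nonpos h]; exact le_add_self
  · rw [lintegral_add_left hgp]
    exact (ENNReal.add_lt_top.2 ⟨lt_top_iff_ne_top.2 hp, lt_top_iff_ne_top.2 hn⟩)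

lemma lintegral_eq_zero_of_mul_le_zero {α : Type*} [MeasurableSpace α] {μ : Measure α}
    {ε : ℝ} (hε : 0 < ε) {t : α → ℝ≥0∞}
    (h : (ε : EReal) * ((∫⁻ x, t x ∂μ : ℝ≥0∞) : EReal) ≤ 0) : ∫⁻ x, t x ∂μ = 0 := by
  by_contra hne
  have h1 : (0 : EReal) < ((∫⁻ x, t x ∂μ : ℝ≥0∞) : EReal) :=
    EReal.coe_ennreal_pos.2 (pos_iff_ne_zero.2 hne)
  exact absurd h (not_le.2 (EReal.mul_pos (by exact_mod_cast hε) h1))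

end ExtendedIntegral

/-! ### Relative entropy: densities, tilting, chain rule -/

section RelativeEntropy

open InformationTheory

/-- Differential entropy in terms of the relative entropy with respect to a probability measure
with positive density `q`. -/
lemma diffEntropy_eq_sub_klDiv {D : ℕ} (ρ : Measure (E D)) [IsProbabilityMeasure ρ] {q : E D → ℝ}
    (hq : Measurable q) (hq0 : ∀ x, 0 < q x)
    [IsProbabilityMeasure (volume.withDensity fun x => ENNReal.ofReal (q x))]
    (hint : Integrable (fun x => Real.log (q x)) ρ) :
    diffEntropy ρ = ((-∫ x, Real.log (q x) ∂ρ : ℝ) : EReal)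
      - (klDiv ρ (volume.withDensity fun x => ENNReal.ofReal (q x)) : EReal) := by
  set ν := (volume : Measure (E D)).withDensity fun x => ENNReal.ofReal (q x) with hν
  have hac : volume ≪ ν := withDensity_absolutelyContinuous' hq.ennreal_ofReal.aemeasurable
    (ae_of_all _ fun x => by simpa using hq0 x)
  by_cases h : ρ ≪ volume
  · rw [diffEntropy, if_pos h, klDiv_eq_lintegral_klFun_of_ac (h.trans hac)]
    set r : E D → ℝ := fun x => (ρ.rnDeriv volume x).toReal with hr
    have hrm : Measurable r := (Measure.measurable_rnDeriv _ _).ennreal_toReal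
    have hri : Integrable r volume := Measure.integrable_toReal_rnDeriv
    have hr1 : ∫ x, r x = 1 := by
      rw [hr, Measure.integral_toReal_rnDeriv h]; simp
    have hlq : Integrable q volume := by
      have h1 : ∫⁻ x, ENNReal.ofReal (q x) = 1 := by
        have := measure_univ (μ := ν)
        rwa [hν, withDensity_apply _ MeasurableSet.univ, Measure.restrict_univ] at this
      refine ⟨hq.aestronglyMeasurable, ?_⟩
      rw [hasFiniteIntegral_iff_ofReal (ae_of_all _ fun x => (hq0 x).le), h1]
      simp
    have hq1 : ∫ x, q x = 1 := by
      rw [integral_eq_lintegral_of_nonneg_ae (ae_of_all _ fun x => (hq0 x).le)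
        hq.aestronglyMeasurable]
      have := measure_univ (μ := ν)
      rw [hν, withDensity_apply _ MeasurableSet.univ, Measure.restrict_univ] at this
      rw [this]; simp
    have hrl : Integrable (fun x => r x * Real.log (q x)) volume :=
      (integrable_toReal_rnDeriv_mul_iff h).2 hint
    have hrl1 : ∫ x, r x * Real.log (q x) = ∫ x, Real.log (q x) ∂ρ :=
      integral_toReal_rnDeriv_mul h
    have hkl : ∫⁻ x, ENNReal.ofReal (klFun (ρ.rnDeriv ν x).toReal) ∂ν
        = ∫⁻ x, ENNReal.ofReal (q x * klFun (r x / q x)) := by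
      have hrn := Measure.rnDeriv_withDensity_right ρ volume hq.ennreal_ofReal.aemeasurable
        (ae_of_all _ fun x => by simpa using hq0 x) (ae_of_all _ fun x => ENNReal.ofReal_ne_top)
      have h2 : ∀ᵐ x ∂ν, ENNReal.ofReal (klFun (ρ.rnDeriv ν x).toReal)
          = ENNReal.ofReal (klFun (r x / q x)) := by
        filter_upwards [(withDensity_absolutelyContinuous _ _).ae_le hrn] with x hx
        rw [← hν] at hx
        rw [hx, ENNReal.toReal_mul, ENNReal.toReal_inv, ENNReal.toReal_ofReal (hq0 x).le,
          inv_mul_eq_div]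
      have h3 : Measurable fun x => ENNReal.ofReal (klFun (r x / q x)) :=
        (measurable_klFun.comp (hrm.div hq)).ennreal_ofReal
      rw [lintegral_congr_ae h2, hν,
        lintegral_withDensity_eq_lintegral_mul _ hq.ennreal_ofReal h3]
      refine lintegral_congr fun x => ?_
      simp only [Pi.mul_apply]
      rw [ENNReal.ofReal_mul (hq0 x).le]
    have hai : Integrable (fun x => q x - r x - r x * Real.log (q x)) volume :=
      (hlq.sub hri).sub hrl
    have hpt : ∀ x, ((Real.negMulLog (r x) : ℝ) : EReal)
        = ((q x - r x - r x * Real.log (q x) : ℝ) : EReal)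
          - ((ENNReal.ofReal (q x * klFun (r x / q x)) : ℝ≥0∞) : EReal) := by
      intro x
      have h0 : 0 ≤ r x := ENNReal.toReal_nonneg
      have h3 : 0 ≤ q x * klFun (r x / q x) :=
        mul_nonneg (hq0 x).le (klFun_nonneg (div_nonneg h0 (hq0 x).le))
      rw [EReal.coe_ennreal_ofReal, max_eq_left h3, ← EReal.coe_sub]
      congr 1
      rw [klFun_apply, Real.negMulLog]
      rcases h0.eq_or_lt with h4 | h4
      · simp [← h4]
      · rw [Real.log_div h4.ne' (hq0 x).ne']
        have := (hq0 x).ne'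
        field_simp
        ring
    have hmeas : Measurable fun x => ENNReal.ofReal (q x * klFun (r x / q x)) :=
      (hq.mul (measurable_klFun.comp (hrm.div hq))).ennreal_ofReal
    change extIntegral volume (fun x => ((Real.negMulLog (r x) : ℝ) : EReal)) = _
    rw [hkl]
    simp only [hpt]
    rw [extIntegral_sub hai hmeas.aemeasurable, integral_sub (f := fun x => q x - r x) (hlq.sub hri) hrl,
      integral_sub hlq hri, hq1, hr1, hrl1]
    simp
  · have h' : ¬ ρ ≪ ν := fun h'' => h (h''.trans (withDensity_absolutelyContinuous _ _))
    rw [diffEntropy, if_neg h, klDiv_of_not_ac h']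
    simp

/-- The Gibbs variational identity: the defect in the variational inequality
`∫ f dρ - log ∫ exp f dκ ≤ KL(ρ | κ)` is the relative entropy with respect to the tilted measure. -/
lemma klDiv_tilted_right {Y : Type*} [MeasurableSpace Y] {ρ κ : Measure Y}
    [IsProbabilityMeasure ρ] [IsProbabilityMeasure κ] {f : Y → ℝ} (hf : Integrable f ρ)
    (hexp : Integrable (fun y => Real.exp (f y)) κ) (hkl : klDiv ρ κ ≠ ⊤) :
    klDiv ρ (κ.tilted f) ≠ ⊤ ∧ (klDiv ρ κ).toReal
      = ∫ y, f y ∂ρ - Real.log (∫ y, Real.exp (f y) ∂κ) + (klDiv ρ (κ.tilted f)).toReal := by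
  obtain ⟨hac, hllr⟩ := klDiv_ne_top_iff.1 hkl
  have hac' : ρ ≪ κ.tilted f := hac.trans (absolutelyContinuous_tilted hexp)
  have : IsProbabilityMeasure (κ.tilted f) := isProbabilityMeasure_tilted hexp
  refine ⟨klDiv_ne_top hac' (integrable_llr_tilted_right hac hf hllr hexp), ?_⟩
  rw [toReal_klDiv_of_measure_eq hac (by simp), toReal_klDiv_of_measure_eq hac' (by simp),
    integral_llr_tilted_right hac hf hexp hllr]
  ring

/-- Relative entropy of a measure given by a density. -/
lemma klDiv_withDensity {Z : Type*} [MeasurableSpace Z] {τ : Measure Z} [IsFiniteMeasure τ]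
    {g : Z → ℝ≥0∞} (hg : Measurable g) [IsFiniteMeasure (τ.withDensity g)] :
    klDiv (τ.withDensity g) τ = ∫⁻ z, ENNReal.ofReal (klFun (g z).toReal) ∂τ := by
  rw [klDiv_eq_lintegral_klFun_of_ac (withDensity_absolutelyContinuous _ _)]
  refine lintegral_congr_ae ?_
  filter_upwards [Measure.rnDeriv_withDensity τ hg] with z hz
  rw [hz]

variable {X Y : Type*} [MeasurableSpace X] [MeasurableSpace Y]
  [MeasurableSpace.CountableOrCountablyGenerated X Y]

lemma klDiv_kernel_eq (η κ : Kernel X Y) [IsFiniteKernel η] [IsFiniteKernel κ] (x : X)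
    (h : η x ≪ κ x) : klDiv (η x) (κ x)
      = ∫⁻ y, ENNReal.ofReal (klFun (Kernel.rnDeriv η κ x y).toReal) ∂κ x := by
  rw [klDiv_eq_lintegral_klFun_of_ac h]
  refine lintegral_congr_ae ?_
  filter_upwards [Kernel.rnDeriv_eq_rnDeriv_measure (κ := η) (η := κ) (a := x)] with y hy
  rw [hy]

lemma measurable_klDiv_kernel (η κ : Kernel X Y) [IsFiniteKernel η] [IsFiniteKernel κ] :
    Measurable fun x => klDiv (η x) (κ x) := by
  classical
  have h1 : (fun x => klDiv (η x) (κ x)) = fun x => if η x ≪ κ x then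
      ∫⁻ y, ENNReal.ofReal (klFun (Kernel.rnDeriv η κ x y).toReal) ∂κ x else ⊤ := by
    ext x
    split_ifs with h
    · exact klDiv_kernel_eq η κ x h
    · exact klDiv_of_not_ac h
  rw [h1]
  refine Measurable.ite (Kernel.measurableSet_absolutelyContinuous η κ) ?_ measurable_const
  exact Measurable.lintegral_kernel_prod_right
    (measurable_klFun.comp (Kernel.measurable_rnDeriv η κ).ennreal_toReal).ennreal_ofReal

/-- The chain rule for the relative entropy of two measures with the same first marginal. -/
lemma klDiv_compProd_eq_lintegral (μ : Measure X) [IsFiniteMeasure μ] (η κ : Kernel X Y)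
    [IsMarkovKernel η] [IsMarkovKernel κ] :
    klDiv (μ ⊗ₘ η) (μ ⊗ₘ κ) = ∫⁻ x, klDiv (η x) (κ x) ∂μ := by
  by_cases h : ∀ᵐ x ∂μ, η x ≪ κ x
  · have h1 : μ ⊗ₘ η
        = (μ ⊗ₘ κ).withDensity (fun p => Kernel.rnDeriv η κ p.1 p.2) := by
      rw [← Measure.compProd_withDensity (κ := κ) (Kernel.measurable_rnDeriv η κ)]
      refine Measure.compProd_congr ?_
      filter_upwards [h] with x hx
      exact (Kernel.withDensity_rnDeriv_eq hx).symm
    have h2 : IsFiniteMeasure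
        ((μ ⊗ₘ κ).withDensity (fun p => Kernel.rnDeriv η κ p.1 p.2)) := by
      rw [← h1]; infer_instance
    have h3 : Measurable fun p : X × Y =>
        ENNReal.ofReal (klFun (Kernel.rnDeriv η κ p.1 p.2).toReal) :=
      (measurable_klFun.comp (Kernel.measurable_rnDeriv η κ).ennreal_toReal).ennreal_ofReal
    rw [h1, klDiv_withDensity (Kernel.measurable_rnDeriv η κ), Measure.lintegral_compProd h3]
    refine lintegral_congr_ae ?_
    filter_upwards [h] with x hx
    rw [klDiv_kernel_eq η κ x hx]
  · have h1 : ¬ (μ ⊗ₘ η ≪ μ ⊗ₘ κ) := by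
      rwa [Measure.absolutelyContinuous_compProd_right_iff]
    rw [klDiv_of_not_ac h1]
    by_contra h2
    refine h ?_
    filter_upwards [ae_lt_top (measurable_klDiv_kernel η κ) (Ne.symm h2)] with x hx
    by_contra h3
    rw [klDiv_of_not_ac h3] at hx
    exact lt_irrefl _ hx

/-- Young's inequality for the relative entropy: a function with finite exponential moment under
the reference measure is integrable under every measure of finite relative entropy. -/
lemma lintegral_ne_top_of_klDiv_ne_top {Z : Type*} [MeasurableSpace Z] {π τ : Measure Z}
    [IsFiniteMeasure π] [IsFiniteMeasure τ] (h : klDiv π τ ≠ ⊤) {a : Z → ℝ} (ha : Measurable a)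
    (hexp : ∫⁻ z, ENNReal.ofReal (Real.exp (a z)) ∂τ ≠ ⊤) :
    ∫⁻ z, ENNReal.ofReal (a z) ∂π ≠ ⊤ := by
  have hac := (klDiv_ne_top_iff.1 h).1
  rw [klDiv_eq_lintegral_klFun_of_ac hac] at h
  rw [← lintegral_rnDeriv_mul hac ha.ennreal_ofReal.aemeasurable]
  have h1 : ∫⁻ z, (ENNReal.ofReal (klFun (π.rnDeriv τ z).toReal)
      + ENNReal.ofReal (Real.exp (a z))) ∂τ ≠ ⊤ := by
    rw [lintegral_add_right _ ha.exp.ennreal_ofReal]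
    exact ENNReal.add_ne_top.2 ⟨h, hexp⟩
  refine ne_top_of_le_ne_top h1 (lintegral_mono_ae ?_)
  filter_upwards [Measure.rnDeriv_lt_top π τ] with z hz
  set t := (π.rnDeriv τ z).toReal with ht
  have ht0 : 0 ≤ t := ENNReal.toReal_nonneg
  rw [← ENNReal.ofReal_toReal hz.ne, ← ht, ← ENNReal.ofReal_mul ht0,
    ← ENNReal.ofReal_add (klFun_nonneg ht0) (Real.exp_pos _).le]
  refine ENNReal.ofReal_le_ofReal ?_
  rw [klFun_apply]
  rcases ht0.eq_or_lt with h0 | h0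
  · rw [← h0]
    have := Real.exp_pos (a z)
    simp
    linarith
  · have h2 := Real.add_one_le_exp (a z - Real.log t)
    rw [Real.exp_sub, Real.exp_log h0, le_div_iff₀ h0] at h2
    nlinarith

end RelativeEntropy

/-! ### Strict convexity of the relative entropy -/

section StrictConvexity

open InformationTheory

/-- Strict convexity of the relative entropy in its first argument. -/
lemma eq_of_klDiv_le_klDiv_midpoint {Z : Type*} [MeasurableSpace Z] {π₁ π₂ τ : Measure Z}
    [IsFiniteMeasure π₁] [IsFiniteMeasure π₂] [IsFiniteMeasure τ] {K : ℝ≥0∞} (hK : K ≠ ⊤)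
    (h1 : klDiv π₁ τ = K) (h2 : klDiv π₂ τ = K)
    (hmid : K ≤ klDiv ((2 : ℝ≥0∞)⁻¹ • π₁ + (2 : ℝ≥0∞)⁻¹ • π₂) τ) : π₁ = π₂ := by
  have hac1 := (klDiv_ne_top_iff.1 (h1 ▸ hK)).1
  have hac2 := (klDiv_ne_top_iff.1 (h2 ▸ hK)).1
  set g₁ := π₁.rnDeriv τ with hg₁
  set g₂ := π₂.rnDeriv τ with hg₂
  have m1 : Measurable g₁ := Measure.measurable_rnDeriv _ _
  have m2 : Measurable g₂ := Measure.measurable_rnDeriv _ _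
  have e1 : τ.withDensity g₁ = π₁ := Measure.withDensity_rnDeriv_eq _ _ hac1
  have e2 : τ.withDensity g₂ = π₂ := Measure.withDensity_rnDeriv_eq _ _ hac2
  have m3 : Measurable fun z => (2 : ℝ≥0∞)⁻¹ * g₁ z + (2 : ℝ≥0∞)⁻¹ * g₂ z := by fun_prop
  have e3 : (2 : ℝ≥0∞)⁻¹ • π₁ + (2 : ℝ≥0∞)⁻¹ • π₂
      = τ.withDensity fun z => (2 : ℝ≥0∞)⁻¹ * g₁ z + (2 : ℝ≥0∞)⁻¹ * g₂ z := by
    rw [← e1, ← e2, ← withDensity_smul _ m1, ← withDensity_smul _ m2,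
      ← withDensity_add_left (m1.const_smul _)]
    rfl
  have hfin : IsFiniteMeasure
      (τ.withDensity fun z => (2 : ℝ≥0∞)⁻¹ * g₁ z + (2 : ℝ≥0∞)⁻¹ * g₂ z) := by
    rw [← e3]
    have := Measure.smul_finite π₁ (c := (2 : ℝ≥0∞)⁻¹) (by simp)
    have := Measure.smul_finite π₂ (c := (2 : ℝ≥0∞)⁻¹) (by simp)
    infer_instance
  rw [e3, klDiv_withDensity m3] at hmid
  rw [klDiv_eq_lintegral_klFun_of_ac hac1, ← hg₁] at h1
  rw [klDiv_eq_lintegral_klFun_of_ac hac2, ← hg₂] at h2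
  have mk1 : Measurable fun z => ENNReal.ofReal (klFun (g₁ z).toReal) :=
    (measurable_klFun.comp m1.ennreal_toReal).ennreal_ofReal
  have mk2 : Measurable fun z => ENNReal.ofReal (klFun (g₂ z).toReal) :=
    (measurable_klFun.comp m2.ennreal_toReal).ennreal_ofReal
  have hmean : ∫⁻ z, ((2 : ℝ≥0∞)⁻¹ * ENNReal.ofReal (klFun (g₁ z).toReal)
      + (2 : ℝ≥0∞)⁻¹ * ENNReal.ofReal (klFun (g₂ z).toReal)) ∂τ = K := by
    rw [lintegral_add_left (mk1.const_mul _), lintegral_const_mul _ mk1, lintegral_const_mul _ mk2,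
      h1, h2, ← add_mul, ENNReal.inv_two_add_inv_two, one_mul]
  have hreal : ∀ᵐ z ∂τ, ((2 : ℝ≥0∞)⁻¹ * g₁ z + (2 : ℝ≥0∞)⁻¹ * g₂ z).toReal
      = (1 / 2 : ℝ) • (g₁ z).toReal + (1 / 2 : ℝ) • (g₂ z).toReal := by
    filter_upwards [Measure.rnDeriv_ne_top π₁ τ, Measure.rnDeriv_ne_top π₂ τ] with z hz1 hz2
    rw [ENNReal.toReal_add (ENNReal.mul_ne_top (by simp) hz1) (ENNReal.mul_ne_top (by simp) hz2),
      ENNReal.toReal_mul, ENNReal.toReal_mul]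
    simp [hg₁, hg₂]
  have hmeanpt : ∀ z, (2 : ℝ≥0∞)⁻¹ * ENNReal.ofReal (klFun (g₁ z).toReal)
      + (2 : ℝ≥0∞)⁻¹ * ENNReal.ofReal (klFun (g₂ z).toReal)
      = ENNReal.ofReal ((1 / 2 : ℝ) • klFun (g₁ z).toReal + (1 / 2 : ℝ) • klFun (g₂ z).toReal) := by
    intro z
    have k1 := klFun_nonneg (ENNReal.toReal_nonneg (a := g₁ z))
    have k2 := klFun_nonneg (ENNReal.toReal_nonneg (a := g₂ z))
    have : (2 : ℝ≥0∞)⁻¹ = ENNReal.ofReal (1 / 2) := by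
      rw [one_div, ENNReal.ofReal_inv_of_pos two_pos]; simp
    rw [this, ← ENNReal.ofReal_mul (by norm_num), ← ENNReal.ofReal_mul (by norm_num),
      ← ENNReal.ofReal_add (by positivity) (by positivity)]
    rfl
  have hle : (fun z => ENNReal.ofReal (klFun ((2 : ℝ≥0∞)⁻¹ * g₁ z + (2 : ℝ≥0∞)⁻¹ * g₂ z).toReal))
      ≤ᵐ[τ] fun z => (2 : ℝ≥0∞)⁻¹ * ENNReal.ofReal (klFun (g₁ z).toReal)
        + (2 : ℝ≥0∞)⁻¹ * ENNReal.ofReal (klFun (g₂ z).toReal) := by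
    filter_upwards [hreal] with z hz
    rw [hz, hmeanpt]
    exact ENNReal.ofReal_le_ofReal (convexOn_klFun.2 (Set.mem_Ici.2 ENNReal.toReal_nonneg)
      (Set.mem_Ici.2 ENNReal.toReal_nonneg) (by norm_num) (by norm_num) (by norm_num))
  have heq := ae_eq_of_ae_le_of_lintegral_le hle
    (ne_top_of_le_ne_top (hmean ▸ hK) (lintegral_mono_ae hle))
    ((mk1.const_mul _).add (mk2.const_mul _)).aemeasurable (by rw [hmean]; exact hmid)
  rw [← e1, ← e2]
  refine withDensity_congr_ae ?_
  filter_upwards [heq, hreal, Measure.rnDeriv_ne_top π₁ τ, Measure.rnDeriv_ne_top π₂ τ]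
    with z hz hz' hz1 hz2
  rw [hz', hmeanpt] at hz
  by_contra hne
  have hne' : (g₁ z).toReal ≠ (g₂ z).toReal := fun h =>
    hne ((ENNReal.toReal_eq_toReal_iff' hz1 hz2).1 h)
  have hlt := strictConvexOn_klFun.2 (Set.mem_Ici.2 (ENNReal.toReal_nonneg (a := g₁ z)))
    (Set.mem_Ici.2 (ENNReal.toReal_nonneg (a := g₂ z))) hne'
    (by norm_num : (0 : ℝ) < 1 / 2) (by norm_num : (0 : ℝ) < 1 / 2) (by norm_num)
  have hnn : 0 ≤ klFun ((1 / 2 : ℝ) • (g₁ z).toReal + (1 / 2 : ℝ) • (g₂ z).toReal) :=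
    klFun_nonneg (by simp only [smul_eq_mul]; positivity)
  exact absurd hz (((ENNReal.ofReal_lt_ofReal_iff (hnn.trans_lt hlt)).2 hlt).ne)

end StrictConvexity

/-! ### The Gaussian reference kernel -/

section GaussianKernel

variable {D : ℕ} {ε : ℝ}

/-- The density of the Gaussian measure with mean `x` and covariance `ε I`. -/
noncomputable def gaussDensity (ε : ℝ) (x y : E D) : ℝ :=
  (2 * Real.pi * ε) ^ (-(D : ℝ) / 2) * Real.exp (-(‖x - y‖ ^ 2 / 2) / ε)

/-- The Markov kernel `x ↦ N(x, ε I)`, the law of `x + √ε z` for a standard Gaussian `z`. -/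
noncomputable def gaussKernel (D : ℕ) (ε : ℝ) : Kernel (E D) (E D) :=
  (Kernel.id ×ₖ Kernel.const (E D) (stdGaussian (E D))).map (fun p => p.1 + √ε • p.2)

instance : IsMarkovKernel (gaussKernel D ε) :=
  Kernel.IsMarkovKernel.map _ (by fun_prop)

lemma gaussKernel_apply (ε : ℝ) (x : E D) :
    gaussKernel D ε x = (stdGaussian (E D)).map (fun z => x + √ε • z) := by
  rw [gaussKernel, Kernel.map_apply _ (by fun_prop), Kernel.prod_apply, Kernel.id_apply,
    Kernel.const_apply, Measure.dirac_prod, Measure.map_map (by fun_prop) (by fun_prop)]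
  rfl

lemma gaussDensity_pos (hε : 0 < ε) (x y : E D) : 0 < gaussDensity ε x y := by
  unfold gaussDensity
  positivity

lemma measurable_gaussDensity_right (x : E D) : Measurable (gaussDensity ε x) := by
  unfold gaussDensity
  fun_prop

lemma log_gaussDensity (hε : 0 < ε) (x y : E D) : Real.log (gaussDensity ε x y)
    = -((D : ℝ) / 2 * Real.log (2 * Real.pi * ε)) - ‖x - y‖ ^ 2 / 2 / ε := by
  unfold gaussDensity
  rw [Real.log_mul (by positivity) (Real.exp_pos _).ne', Real.log_exp,
    Real.log_rpow (by positivity)]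
  ring

lemma integral_gaussDensity (hε : 0 < ε) (x : E D) : ∫ y, gaussDensity ε x y = 1 := by
  have h1 : ∀ y, gaussDensity ε x (x + y)
      = (2 * Real.pi * ε) ^ (-(D : ℝ) / 2) * Real.exp (-(1 / (2 * ε)) * ‖y‖ ^ 2) := by
    intro y
    simp only [gaussDensity, sub_add_cancel_left, norm_neg]
    congr 2
    field_simp
  rw [← integral_add_left_eq_self _ x]
  simp only [h1]
  rw [integral_const_mul, GaussianFourier.integral_rexp_neg_mul_sq_norm (by positivity),
    show Real.pi / (1 / (2 * ε)) = 2 * Real.pi * ε by field_simp, ← Real.rpow_add (by positivity)]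
  rw [finrank_euclideanSpace_fin, neg_div, neg_add_cancel, Real.rpow_zero]

lemma integrable_gaussDensity (hε : 0 < ε) (x : E D) : Integrable (gaussDensity ε x) :=
  Integrable.of_integral_ne_zero (by rw [integral_gaussDensity hε]; exact one_ne_zero)

lemma isProbabilityMeasure_gaussDensity (hε : 0 < ε) (x : E D) :
    IsProbabilityMeasure (volume.withDensity fun y => ENNReal.ofReal (gaussDensity ε x y)) := by
  constructor
  rw [withDensity_apply _ MeasurableSet.univ, Measure.restrict_univ,
    ← ofReal_integral_eq_lintegral_ofReal (integrable_gaussDensity hε x)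
      (ae_of_all _ fun y => (gaussDensity_pos hε x y).le), integral_gaussDensity hε]
  simp

/-- The law of `x + √ε z` has density `gaussDensity ε x`; both have the same characteristic
function. -/
lemma gaussKernel_eq_withDensity (hε : 0 < ε) (x : E D) :
    gaussKernel D ε x = volume.withDensity fun y => ENNReal.ofReal (gaussDensity ε x y) := by
  have := isProbabilityMeasure_gaussDensity hε x
  have := (inferInstance : IsMarkovKernel (gaussKernel D ε)).isProbabilityMeasure x
  refine Measure.ext_of_charFun (funext fun t => ?_)
  have e1 : (stdGaussian (E D)).map (fun z => x + √ε • z)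
      = ((stdGaussian (E D)).map (fun z => √ε • z)).map (fun z => x + z) := by
    rw [Measure.map_map (by fun_prop) (by fun_prop)]
    rfl
  rw [gaussKernel_apply, e1, charFun_map_const_add, charFun_map_smul, charFun_stdGaussian,
    charFun_apply, integral_withDensity_eq_integral_toReal_smul
      (measurable_gaussDensity_right x).ennreal_ofReal (ae_of_all _ fun y => ENNReal.ofReal_lt_top),
    ← integral_add_left_eq_self _ x]
  have h1 : ∀ y : E D, (ENNReal.ofReal (gaussDensity ε x (x + y))).toReal
        • Complex.exp (inner ℝ (x + y) t * Complex.I)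
      = (((2 * Real.pi * ε) ^ (-(D : ℝ) / 2) : ℝ) * Complex.exp (inner ℝ x t * Complex.I))
        * Complex.exp (-((1 / (2 * ε) : ℝ) : ℂ) * ‖y‖ ^ 2 + Complex.I * inner ℝ t y) := by
    intro y
    rw [ENNReal.toReal_ofReal (gaussDensity_pos hε _ _).le, Complex.real_smul, gaussDensity,
      inner_add_left, real_inner_comm y t, Complex.exp_add]
    push_cast
    rw [add_mul, Complex.exp_add, sub_add_cancel_left, norm_neg]
    have : -((‖y‖ : ℂ) ^ 2 / 2) / ε = -(1 / (2 * (ε : ℂ))) * (‖y‖ : ℂ) ^ 2 := by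
      have : (ε : ℂ) ≠ 0 := by exact_mod_cast hε.ne'
      field_simp
    rw [this, mul_comm Complex.I]
    ring
  simp only [h1]
  rw [integral_const_mul, GaussianFourier.integral_cexp_neg_mul_sq_norm_add
    (by rw [Complex.ofReal_re]; positivity)]
  have h2 : ((Real.pi : ℂ) / ((1 / (2 * ε) : ℝ) : ℂ)) ^ ((Module.finrank ℝ (E D) : ℂ) / 2)
      = (((2 * Real.pi * ε) ^ ((D : ℝ) / 2) : ℝ) : ℂ) := by
    rw [Complex.ofReal_cpow (by positivity), finrank_euclideanSpace_fin]
    congr 1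
    · push_cast
      have : (ε : ℂ) ≠ 0 := by exact_mod_cast hε.ne'
      field_simp
    · push_cast; rfl
  have h3 : ((2 * Real.pi * ε) ^ (-(D : ℝ) / 2) : ℝ) * ((2 * Real.pi * ε) ^ ((D : ℝ) / 2) : ℝ)
      = 1 := by
    rw [← Real.rpow_add (by positivity), neg_div, neg_add_cancel, Real.rpow_zero]
  rw [h2]
  have h4 : Complex.exp (Complex.I ^ 2 * ‖t‖ ^ 2 / (4 * ((1 / (2 * ε) : ℝ) : ℂ)))
      = Complex.exp (-(‖√ε • t‖ : ℂ) ^ 2 / 2) := by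
    congr 1
    rw [norm_smul, Real.norm_eq_abs, abs_of_nonneg (Real.sqrt_nonneg _), Complex.I_sq,
      Complex.ofReal_mul, mul_pow, ← Complex.ofReal_pow (√ε), Real.sq_sqrt hε.le]
    push_cast
    have : (ε : ℂ) ≠ 0 := by exact_mod_cast hε.ne'
    field_simp
    ring
  rw [h4]
  calc _ = (1 : ℂ) * (Complex.exp (-(‖√ε • t‖ : ℂ) ^ 2 / 2)
        * Complex.exp (inner ℝ x t * Complex.I)) := by rw [one_mul]
    _ = ((((2 * Real.pi * ε) ^ (-(D : ℝ) / 2) : ℝ) * ((2 * Real.pi * ε) ^ ((D : ℝ) / 2) : ℝ) : ℝ)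
        : ℂ) * (Complex.exp (-(‖√ε • t‖ : ℂ) ^ 2 / 2)
        * Complex.exp (inner ℝ x t * Complex.I)) := by rw [h3, Complex.ofReal_one]
    _ = _ := by push_cast; ring

lemma lintegral_gaussKernel {F : E D → ℝ≥0∞} (hF : Measurable F) (x : E D) :
    ∫⁻ y, F y ∂gaussKernel D ε x = ∫⁻ z, F (x + √ε • z) ∂(stdGaussian (E D)) := by
  rw [gaussKernel_apply, lintegral_map hF (by fun_prop)]

lemma lintegral_gaussKernel_eq_density (hε : 0 < ε) {F : E D → ℝ≥0∞} (hF : Measurable F)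
    (x : E D) : ∫⁻ y, F y ∂gaussKernel D ε x
      = ∫⁻ y, ENNReal.ofReal (gaussDensity ε x y) * F y := by
  rw [gaussKernel_eq_withDensity hε,
    lintegral_withDensity_eq_lintegral_mul _ (measurable_gaussDensity_right x).ennreal_ofReal hF]
  rfl

/-- A finite exponential moment of the squared norm of a standard Gaussian vector. -/
lemma lintegral_exp_sq_stdGaussian_ne_top :
    ∫⁻ z, ENNReal.ofReal (Real.exp (‖z‖ ^ 2 / 4)) ∂(stdGaussian (E D)) ≠ ⊤ := by
  have h1 := lintegral_gaussKernel (D := D) (ε := 1)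
    (F := fun z => ENNReal.ofReal (Real.exp (‖z‖ ^ 2 / 4))) (by fun_prop) 0
  simp only [zero_add, Real.sqrt_one, one_smul] at h1
  rw [← h1, lintegral_gaussKernel_eq_density one_pos (by fun_prop)]
  -- the integrand is a multiple of the Gaussian density of covariance `2 I`
  have h2 : ∀ y : E D, ENNReal.ofReal (gaussDensity 1 0 y) * ENNReal.ofReal (Real.exp (‖y‖ ^ 2 / 4))
      = ENNReal.ofReal ((2 * Real.pi * 1) ^ (-(D : ℝ) / 2) / (2 * Real.pi * 2) ^ (-(D : ℝ) / 2)
        * gaussDensity 2 0 y) := by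
    intro y
    rw [← ENNReal.ofReal_mul (gaussDensity_pos one_pos _ _).le]
    congr 1
    unfold gaussDensity
    have h3 : ((2 : ℝ) * Real.pi * 2) ^ (-(D : ℝ) / 2) ≠ 0 := by positivity
    rw [mul_assoc, ← Real.exp_add, ← mul_assoc, div_mul_cancel₀ _ h3]
    congr 2
    simp only [zero_sub, norm_neg]
    ring
  simp only [h2]
  have h4 := ((integrable_gaussDensity (D := D) (ε := 2) two_pos 0).const_mul
    ((2 * Real.pi * 1) ^ (-(D : ℝ) / 2) / (2 * Real.pi * 2) ^ (-(D : ℝ) / 2)))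
  exact ((lintegral_ofReal_le_lintegral_enorm _).trans_lt h4.2).ne

end GaussianKernel

/-! ### The transport objective as a relative entropy -/

section Objective

open InformationTheory

variable {D : ℕ} {ε : ℝ} {p₀ : Measure (E D)} {π : ProbabilityMeasure (E D × E D)}

lemma compProd_conditional (hπ : (π : Measure (E D × E D)).fst = p₀) :
    p₀ ⊗ₘ (π : Measure (E D × E D)).condKernel = π := by
  rw [← hπ]
  exact Measure.disintegrate _ _

variable [IsProbabilityMeasure p₀]

/-- The relative entropy of a plan with respect to the reference measure, fiber by fiber. -/
lemma klDiv_eq_lintegral_conditional (hπ : (π : Measure (E D × E D)).fst = p₀) :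
    klDiv (π : Measure (E D × E D)) (p₀ ⊗ₘ gaussKernel D ε)
      = ∫⁻ x, klDiv (conditional π x) (gaussKernel D ε x) ∂p₀ := by
  conv_lhs => rw [← compProd_conditional hπ]
  exact klDiv_compProd_eq_lintegral _ _ _

lemma transportCost_ne_top (hε : 0 < ε)
    (h : klDiv (π : Measure (E D × E D)) (p₀ ⊗ₘ gaussKernel D ε) ≠ ⊤) :
    transportCost π ≠ ⊤ := by
  have ham : Measurable fun x : E D × E D => ‖x.1 - x.2‖ ^ 2 / (4 * ε) := by fun_prop
  have h1 : ∫⁻ p : E D × E D, ENNReal.ofReal (Real.exp (‖p.1 - p.2‖ ^ 2 / (4 * ε)))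
      ∂(p₀ ⊗ₘ gaussKernel D ε) ≠ ⊤ := by
    rw [Measure.lintegral_compProd (by fun_prop)]
    have h2 : ∀ x : E D, ∫⁻ y, ENNReal.ofReal (Real.exp (‖x - y‖ ^ 2 / (4 * ε)))
        ∂(gaussKernel D ε x)
        = ∫⁻ z, ENNReal.ofReal (Real.exp (‖z‖ ^ 2 / 4)) ∂(stdGaussian (E D)) := by
      intro x
      rw [lintegral_gaussKernel (by fun_prop)]
      refine lintegral_congr fun z => ?_
      rw [sub_add_cancel_left, norm_neg, norm_smul, Real.norm_eq_abs, mul_pow, sq_abs,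
        Real.sq_sqrt hε.le]
      congr 2
      field_simp
    simp only [h2]
    simpa using lintegral_exp_sq_stdGaussian_ne_top
  have h3 := lintegral_ne_top_of_klDiv_ne_top h ham h1
  have h4 : transportCost π = ENNReal.ofReal (2 * ε) * ∫⁻ p : E D × E D,
      ENNReal.ofReal (‖p.1 - p.2‖ ^ 2 / (4 * ε)) ∂(π : Measure (E D × E D)) := by
    rw [← lintegral_const_mul _ ham.ennreal_ofReal, transportCost]
    refine lintegral_congr fun p => ?_
    rw [← ENNReal.ofReal_mul (by positivity)]
    congr 1
    field_simp
    ring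
  rw [h4]
  exact ENNReal.mul_ne_top ENNReal.ofReal_ne_top h3

/-- The entropic transport objective is an affine function of the relative entropy with respect to
the Gaussian reference measure. -/
lemma eotObjective_eq_klDiv (hε : 0 < ε) (hπ : (π : Measure (E D × E D)).fst = p₀) :
    eotObjective ε p₀ π
      = (ε : EReal) * (klDiv (π : Measure (E D × E D)) (p₀ ⊗ₘ gaussKernel D ε) : EReal)
        - ((ε * ((D : ℝ) / 2 * Real.log (2 * Real.pi * ε)) : ℝ) : EReal) := by
  by_cases hc : transportCost π = ⊤
  · have h1 : klDiv (π : Measure (E D × E D)) (p₀ ⊗ₘ gaussKernel D ε) = ⊤ := by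
      by_contra h
      exact transportCost_ne_top hε h hc
    rw [eotObjective, if_pos hc, h1, EReal.coe_ennreal_top, EReal.coe_mul_top_of_pos hε,
      EReal.top_sub_coe]
  · rw [eotObjective, if_neg hc]
    set c : E D × E D → ℝ := fun p => ‖p.1 - p.2‖ ^ 2 / 2 with hcdef
    have hcm : Measurable c := by fun_prop
    have hc0 : ∀ p, 0 ≤ c p := fun p => by positivity
    have hci : Integrable c (p₀ ⊗ₘ (π : Measure (E D × E D)).condKernel) := by
      rw [compProd_conditional hπ]
      refine ⟨hcm.aestronglyMeasurable, ?_⟩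
      rw [hasFiniteIntegral_iff_ofReal (ae_of_all _ hc0)]
      exact lt_top_iff_ne_top.2 hc
    have hcx := ((Measure.integrable_compProd_iff hci.1).1 hci).1
    set C : E D → ℝ := fun x => ∫ y, c (x, y) ∂(conditional π x) with hC
    have hCi : Integrable C p₀ := hci.integral_compProd
    have hcost : transportCost π = ENNReal.ofReal (∫ x, C x ∂p₀) := by
      rw [hC]
      simp only [conditional]
      rw [← Measure.integral_compProd hci, ofReal_integral_eq_lintegral_ofReal hci
        (ae_of_all _ hc0), compProd_conditional hπ]
      rfl
    set L : ℝ := (D : ℝ) / 2 * Real.log (2 * Real.pi * ε) with hL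
    have hent : (fun x => diffEntropy (conditional π x)) =ᵐ[p₀]
        fun x => ((C x / ε + L : ℝ) : EReal)
          - (klDiv (conditional π x) (gaussKernel D ε x) : EReal) := by
      filter_upwards [hcx] with x hx
      have : IsProbabilityMeasure (conditional π x) := by
        unfold conditional; infer_instance
      have := isProbabilityMeasure_gaussDensity hε x
      have hlog : ∀ y, Real.log (gaussDensity ε x y) = -L - c (x, y) / ε := fun y => by
        rw [log_gaussDensity hε]
      have hx' : Integrable (fun y => c (x, y)) (conditional π x) := hx
      rw [gaussKernel_eq_withDensity hε, diffEntropy_eq_sub_klDiv _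
        (measurable_gaussDensity_right x) (gaussDensity_pos hε x)
        (by simp only [hlog]; exact (integrable_const _).sub (hx'.div_const ε))]
      congr 2
      simp only [hlog]
      rw [integral_sub (integrable_const _) (hx'.div_const ε), integral_div]
      simp only [integral_const, probReal_univ, smul_eq_mul, one_mul, hC]
      ring
    have hkm : Measurable fun x => klDiv (conditional π x) (gaussKernel D ε x) :=
      measurable_klDiv_kernel _ _
    rw [extIntegral_congr_ae hent, extIntegral_sub (a := fun x => C x / ε + L)
      ((hCi.div_const ε).add (integrable_const L))
      hkm.aemeasurable, ← klDiv_eq_lintegral_conditional hπ, hcost,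
      EReal.coe_ennreal_ofReal, max_eq_left
        (integral_nonneg fun x => integral_nonneg fun y => hc0 _),
      integral_add (hCi.div_const ε) (integrable_const L), integral_div]
    simp only [integral_const, probReal_univ, smul_eq_mul, one_mul]
    generalize ∫ x, C x ∂p₀ = c'
    generalize klDiv (π : Measure (E D × E D)) (p₀ ⊗ₘ gaussKernel D ε) = K
    rcases eq_or_ne K ⊤ with h | h
    · rw [h, EReal.coe_ennreal_top, EReal.coe_mul_top_of_pos hε, EReal.top_sub_coe,
        EReal.sub_top, EReal.coe_mul_bot_of_pos hε, EReal.coe_sub_bot]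
    · lift K to NNReal using h
      have e1 : ((K : ℝ≥0∞) : EReal) = ((K : ℝ) : EReal) := rfl
      rw [e1, ← EReal.coe_sub, ← EReal.coe_mul, ← EReal.coe_sub, ← EReal.coe_mul,
        ← EReal.coe_sub]
      congr 1
      field_simp
      ring

end Objective

/-! ### The weak and the variational dual objective -/

section DualObjectives

open InformationTheory

variable {D : ℕ} {ε : ℝ} {f ξ : E D → ℝ} {p₀ p₁ : Measure (E D)}

/-- The partition function `∫ exp (f / ε) dN(x, ε I)` with respect to the Gaussian reference
kernel. -/
noncomputable def normPartition (ε : ℝ) (f : E D → ℝ) (x : E D) : ℝ≥0∞ :=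
  ∫⁻ y, ENNReal.ofReal (Real.exp (f y / ε)) ∂gaussKernel D ε x

lemma partition_eq_normPartition (hε : 0 < ε) (hf : Measurable f) (x : E D) :
    partition ε f x
      = ENNReal.ofReal ((2 * Real.pi * ε) ^ ((D : ℝ) / 2)) * normPartition ε f x := by
  have hm : Measurable fun y => ENNReal.ofReal (Real.exp (f y / ε)) := by fun_prop
  have hm' : Measurable fun y =>
      ENNReal.ofReal (gaussDensity ε x y) * ENNReal.ofReal (Real.exp (f y / ε)) :=
    (measurable_gaussDensity_right x).ennreal_ofReal.mul hm
  rw [normPartition, lintegral_gaussKernel_eq_density hε hm, ← lintegral_const_mul _ hm',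
    partition]
  refine lintegral_congr fun y => ?_
  rw [← ENNReal.ofReal_mul (gaussDensity_pos hε x y).le, ← ENNReal.ofReal_mul (by positivity)]
  congr 1
  have h1 : Real.exp ((f y - ‖x - y‖ ^ 2 / 2) / ε)
      = Real.exp (-(‖x - y‖ ^ 2 / 2) / ε) * Real.exp (f y / ε) := by
    rw [← Real.exp_add]
    congr 1
    ring
  have h2 : (2 * Real.pi * ε) ^ ((D : ℝ) / 2) * (2 * Real.pi * ε) ^ (-(D : ℝ) / 2) = 1 := by
    rw [← Real.rpow_add (by positivity), neg_div, add_neg_cancel, Real.rpow_zero]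
  rw [h1, gaussDensity]
  linear_combination
    (-(Real.exp (-(‖x - y‖ ^ 2 / 2) / ε) * Real.exp (f y / ε))) * h2

lemma normPartition_ne_zero (hf : Measurable f) (x : E D) : normPartition ε f x ≠ 0 := by
  rw [normPartition, Ne, lintegral_eq_zero_iff (by fun_prop)]
  intro h
  have h1 : ∀ᵐ y ∂gaussKernel D ε x, False := by
    filter_upwards [h] with y hy
    simp only [Pi.zero_apply, ENNReal.ofReal_eq_zero] at hy
    exact absurd hy (not_le.2 (Real.exp_pos _))
  exact h1.exists.elim fun _ => id

lemma measurable_normPartition (hf : Measurable f) : Measurable (normPartition ε f) :=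
  Measurable.lintegral_kernel (by fun_prop)

lemma measurable_partition (hε : 0 < ε) (hf : Measurable f) : Measurable (partition ε f) := by
  rw [funext (partition_eq_normPartition hε hf)]
  exact (measurable_normPartition hf).const_mul _

lemma neg_log_partition (hε : 0 < ε) (hf : Measurable f) {x : E D}
    (h : normPartition ε f x ≠ ⊤) : -ENNReal.log (partition ε f x)
      = ((-((D : ℝ) / 2 * Real.log (2 * Real.pi * ε)) - Real.log (normPartition ε f x).toReal : ℝ)
        : EReal) := by
  have hc : 0 < (2 * Real.pi * ε) ^ ((D : ℝ) / 2) := by positivity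
  rw [partition_eq_normPartition hε hf, ENNReal.log_mul_add, ENNReal.log_ofReal_of_pos hc,
    ENNReal.log_pos_real (normPartition_ne_zero hf x) h, Real.log_rpow (by positivity),
    ← EReal.coe_add, ← EReal.coe_neg]
  congr 1
  ring

lemma neg_log_partition_of_eq_top (hε : 0 < ε) (hf : Measurable f) {x : E D}
    (h : normPartition ε f x = ⊤) : -ENNReal.log (partition ε f x) = ⊥ := by
  rw [partition_eq_normPartition hε hf, h, ENNReal.mul_top (by
    rw [Ne, ENNReal.ofReal_eq_zero, not_le]; positivity)]
  simp

lemma shiftedLogPartition_eq (hε : 0 < ε) (hf : Measurable f) {x : E D}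
    (h : normPartition ε f x ≠ ⊤) :
    shiftedLogPartition ε f x = Real.log (normPartition ε f x).toReal := by
  have hz : (normPartition ε f x).toReal ≠ 0 :=
    ENNReal.toReal_ne_zero.2 ⟨normPartition_ne_zero hf x, h⟩
  rw [shiftedLogPartition, partition_eq_normPartition hε hf, ENNReal.toReal_mul,
    ENNReal.toReal_ofReal (by positivity), Real.log_mul (by positivity) hz,
    Real.log_rpow (by positivity)]
  ring

lemma integrable_exp_iff_normPartition (hf : Measurable f) (x : E D) :
    Integrable (fun y => Real.exp (f y / ε)) (gaussKernel D ε x) ↔ normPartition ε f x ≠ ⊤ := by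
  have hm : Measurable fun y => Real.exp (f y / ε) := by fun_prop
  rw [← lt_top_iff_ne_top, normPartition, ← hasFiniteIntegral_iff_ofReal
    (ae_of_all _ fun y => (Real.exp_pos _).le)]
  exact ⟨fun h => h.2, fun h => ⟨hm.aestronglyMeasurable, h⟩⟩

lemma integral_exp_eq_normPartition (hf : Measurable f) (x : E D) :
    ∫ y, Real.exp (f y / ε) ∂gaussKernel D ε x = (normPartition ε f x).toReal := by
  have hm : Measurable fun y => Real.exp (f y / ε) := by fun_prop
  rw [integral_eq_lintegral_of_nonneg_ae (ae_of_all _ fun y => (Real.exp_pos _).le)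
    hm.aestronglyMeasurable, normPartition]

/-- The tilted Gaussian measure has the Gibbs density. -/
lemma tilted_gaussKernel_eq (hε : 0 < ε) (hf : Measurable f) {x : E D}
    (h : normPartition ε f x ≠ ⊤) (hξ : ξ x = shiftedLogPartition ε f x) :
    (gaussKernel D ε x).tilted (fun y => f y / ε)
      = volume.withDensity (fun y => ENNReal.ofReal (gibbsDensity ε f ξ x y)) := by
  have hm : Measurable fun y => ENNReal.ofReal (Real.exp (f y / ε)
      / ∫ z, Real.exp (f z / ε) ∂gaussKernel D ε x) := by fun_prop
  have hz : 0 < (normPartition ε f x).toReal :=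
    ENNReal.toReal_pos (normPartition_ne_zero hf x) h
  rw [Measure.tilted]
  conv_lhs => enter [1]; rw [gaussKernel_eq_withDensity hε]
  rw [← withDensity_mul _ (measurable_gaussDensity_right x).ennreal_ofReal hm]
  congr 1
  ext y
  rw [Pi.mul_apply, ← ENNReal.ofReal_mul (gaussDensity_pos hε x y).le]
  congr 1
  rw [integral_exp_eq_normPartition hf, gibbsDensity, hξ, shiftedLogPartition_eq hε hf h,
    Real.exp_log hz, gaussDensity, mul_div_assoc', mul_assoc, ← Real.exp_add, div_mul_eq_mul_div]
  congr 3
  ring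

lemma varDual_eq (hf : Measurable f) : varDual ε p₀ p₁ f ξ
    = ((ε * (1 - (D : ℝ) / 2 * Real.log (2 * Real.pi * ε))
      + ∫ x₁, f x₁ ∂p₁ - ε * ∫ x₀, ξ x₀ ∂p₀ : ℝ) : EReal)
    - (ε : EReal) * ((∫⁻ x, ENNReal.ofReal (Real.exp (-ξ x)) * normPartition ε f x ∂p₀ : ℝ≥0∞)
      : EReal) := by
  rw [varDual]
  congr 4
  ext x
  have hm : Measurable fun y => ENNReal.ofReal (Real.exp (f y / ε)) := by fun_prop
  have hm' : Measurable fun z : E D => ENNReal.ofReal (Real.exp (f (x + √ε • z) / ε)) :=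
    hm.comp (by fun_prop)
  rw [normPartition, lintegral_gaussKernel hm, ← lintegral_const_mul _ hm']
  refine lintegral_congr fun z => ?_
  rw [← ENNReal.ofReal_mul (Real.exp_pos _).le, ← Real.exp_add]
  congr 2
  ring

lemma varDual_eq_bot (hε : 0 < ε) (hf : Measurable f)
    (h : ∫⁻ x, ENNReal.ofReal (Real.exp (-ξ x)) * normPartition ε f x ∂p₀ = ⊤) :
    varDual ε p₀ p₁ f ξ = ⊥ := by
  rw [varDual_eq hf, h, EReal.coe_ennreal_top, EReal.coe_mul_top_of_pos hε, EReal.sub_top]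

/-- The weak dual objective exceeds the variational one by `ε` times the integral of the nonnegative
function `exp u - 1 - u`, where `u = log Z - ξ`. -/
lemma weakDual_eq_varDual_add [IsProbabilityMeasure p₀] (hε : 0 < ε) (hf : f ∈ potentials p₁)
    (hξ : ξ ∈ potentials p₀)
    (h : ∫⁻ x, ENNReal.ofReal (Real.exp (-ξ x)) * normPartition ε f x ∂p₀ ≠ ⊤) :
    ∃ t : E D → ℝ≥0∞, AEMeasurable t p₀ ∧ (∃ r : ℝ, varDual ε p₀ p₁ f ξ = r) ∧
      weakDual ε p₀ p₁ f
        = varDual ε p₀ p₁ f ξ + (ε : EReal) * ((∫⁻ x, t x ∂p₀ : ℝ≥0∞) : EReal) ∧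
      ∀ᵐ x ∂p₀, normPartition ε f x ≠ ⊤ ∧ (t x = 0 ↔ ξ x = shiftedLogPartition ε f x) := by
  obtain ⟨hfm, hfi⟩ := hf
  obtain ⟨hξm, hξi⟩ := hξ
  set G : E D → ℝ≥0∞ := fun x => ENNReal.ofReal (Real.exp (-ξ x)) * normPartition ε f x with hG
  have hGm : Measurable G :=
    (by fun_prop : Measurable fun x => ENNReal.ofReal (Real.exp (-ξ x))).mul
      (measurable_normPartition hfm)
  set L : ℝ := (D : ℝ) / 2 * Real.log (2 * Real.pi * ε) with hL
  set g : E D → ℝ := fun x => (G x).toReal with hg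
  have hgi : Integrable g p₀ := integrable_toReal_of_lintegral_ne_top hGm.aemeasurable h
  have hgint : ∫ x, g x ∂p₀ = (∫⁻ x, G x ∂p₀).toReal :=
    integral_toReal hGm.aemeasurable (ae_lt_top hGm h)
  set u : E D → ℝ := fun x => Real.log (normPartition ε f x).toReal - ξ x with hu
  set t : E D → ℝ≥0∞ := fun x => ENNReal.ofReal (g x - 1 - u x) with ht
  have hum : Measurable u :=
    (Real.measurable_log.comp (measurable_normPartition hfm).ennreal_toReal).sub hξm
  have htm : Measurable t := ((hGm.ennreal_toReal.sub_const 1).sub hum).ennreal_ofReal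
  have hfin : ∀ᵐ x ∂p₀, normPartition ε f x ≠ ⊤ := by
    filter_upwards [ae_lt_top hGm h] with x hx hx'
    have : G x = ⊤ := by
      simp only [hG]
      rw [hx', ENNReal.mul_top (by simp [Real.exp_pos])]
    exact hx.ne this
  have hgu : ∀ x, normPartition ε f x ≠ ⊤ → g x = Real.exp (u x) := by
    intro x hx
    simp only [hg, hG, hu]
    rw [ENNReal.toReal_mul, ENNReal.toReal_ofReal (Real.exp_pos _).le, sub_eq_add_neg, Real.exp_add,
      Real.exp_log (ENNReal.toReal_pos (normPartition_ne_zero hfm x) hx), mul_comm]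
  have hvar : varDual ε p₀ p₁ f ξ = ((ε * (1 - L) + ∫ x₁, f x₁ ∂p₁ - ε * ∫ x₀, ξ x₀ ∂p₀
      - ε * ∫ x, g x ∂p₀ : ℝ) : EReal) := by
    rw [varDual_eq hfm, hgint]
    change _ - (ε : EReal) * ((∫⁻ x, G x ∂p₀ : ℝ≥0∞) : EReal) = _
    rw [← EReal.coe_ennreal_toReal h, ← EReal.coe_mul, ← EReal.coe_sub]
  refine ⟨t, htm.aemeasurable, ⟨_, hvar⟩, ?_, ?_⟩
  · have hai : Integrable (fun x => -L - ξ x + 1 - g x) p₀ :=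
      (((integrable_const _).sub hξi).add (integrable_const 1)).sub hgi
    have hlog : (fun x => -ENNReal.log (partition ε f x)) =ᵐ[p₀]
        fun x => ((-L - ξ x + 1 - g x : ℝ) : EReal) + (t x : EReal) := by
      filter_upwards [hfin] with x hx
      have h0 : 0 ≤ g x - 1 - u x := by
        rw [hgu x hx]
        have := Real.add_one_le_exp (u x)
        linarith
      rw [neg_log_partition hε hfm hx, ht, EReal.coe_ennreal_ofReal, max_eq_left h0,
        ← EReal.coe_add]
      congr 1
      simp only [hu]
      ring
    rw [weakDual, extIntegral_congr_ae hlog, extIntegral_add hai htm.aemeasurable, hvar,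
      EReal.left_distrib_of_nonneg_of_ne_top (by exact_mod_cast hε.le) (EReal.coe_ne_top _),
      ← add_assoc, ← EReal.coe_mul, ← EReal.coe_add]
    congr 2
    rw [integral_sub (f := fun x => -L - ξ x + 1)
        (((integrable_const _).sub hξi).add (integrable_const 1)) hgi,
      integral_add (f := fun x => -L - ξ x) ((integrable_const _).sub hξi) (integrable_const 1),
      integral_sub (integrable_const _) hξi]
    simp only [integral_const, probReal_univ, smul_eq_mul, one_mul]
    ring
  · filter_upwards [hfin] with x hx
    refine ⟨hx, ?_⟩
    rw [shiftedLogPartition_eq hε hfm hx]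
    simp only [ht, ENNReal.ofReal_eq_zero]
    rw [hgu x hx]
    constructor
    · intro h1
      by_contra h2
      have h3 : u x ≠ 0 := fun h4 => h2 (by simp only [hu] at h4; linarith)
      have := Real.add_one_lt_exp h3
      linarith
    · intro h1
      have : u x = 0 := by simp only [hu]; linarith
      simp [this]

/-- The variational objective is bounded by the weak dual objective. -/
lemma varDual_le_weakDual [IsProbabilityMeasure p₀] (hε : 0 < ε) (hf : f ∈ potentials p₁)
    (hξ : ξ ∈ potentials p₀) : varDual ε p₀ p₁ f ξ ≤ weakDual ε p₀ p₁ f := by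
  by_cases h : ∫⁻ x, ENNReal.ofReal (Real.exp (-ξ x)) * normPartition ε f x ∂p₀ = ⊤
  · rw [varDual_eq_bot hε hf.1 h]
    exact bot_le
  · obtain ⟨t, -, -, hw, -⟩ := weakDual_eq_varDual_add hε hf hξ h
    rw [hw]
    calc _ = varDual ε p₀ p₁ f ξ + 0 := (add_zero _).symm
      _ ≤ _ := by
        gcongr
        exact mul_nonneg (by exact_mod_cast hε.le) (EReal.coe_ennreal_nonneg _)

/-- Where the weak dual objective is finite, the shifted log-partition function is an admissible
potential and realizes its value. -/
lemma varDual_shiftedLogPartition [IsProbabilityMeasure p₀] (hε : 0 < ε) (hf : f ∈ potentials p₁)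
    (h1 : weakDual ε p₀ p₁ f ≠ ⊥) (h2 : weakDual ε p₀ p₁ f ≠ ⊤) :
    shiftedLogPartition ε f ∈ potentials p₀ ∧
      varDual ε p₀ p₁ f (shiftedLogPartition ε f) = weakDual ε p₀ p₁ f := by
  set L : ℝ := (D : ℝ) / 2 * Real.log (2 * Real.pi * ε) with hL
  have hm : Measurable fun x => -ENNReal.log (partition ε f x) :=
    (ENNReal.measurable_log.comp (measurable_partition hε hf.1)).neg
  obtain ⟨hae, hint⟩ := integrable_toReal_of_extIntegral_ne (μ := p₀) hm
    (fun h => h1 (by rw [weakDual, h, EReal.coe_mul_bot_of_pos hε, EReal.add_bot]))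
    (fun h => h2 (by rw [weakDual, h, EReal.coe_mul_top_of_pos hε, EReal.coe_add_top]))
  have hfin : ∀ᵐ x ∂p₀, normPartition ε f x ≠ ⊤ := by
    filter_upwards [hae] with x hx h
    exact hx.1 (neg_log_partition_of_eq_top hε hf.1 h)
  have hpm : Measurable (shiftedLogPartition ε f) :=
    (Real.measurable_log.comp (measurable_partition hε hf.1).ennreal_toReal).sub_const _
  have hpot : shiftedLogPartition ε f ∈ potentials p₀ := by
    refine ⟨hpm, ((hint.neg).sub (integrable_const L)).congr ?_⟩
    filter_upwards [hfin] with x hx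
    simp only [Pi.sub_apply, Pi.neg_apply]
    rw [neg_log_partition hε hf.1 hx, EReal.toReal_coe, shiftedLogPartition_eq hε hf.1 hx]
    ring
  have hG : ∫⁻ x, ENNReal.ofReal (Real.exp (-shiftedLogPartition ε f x)) * normPartition ε f x ∂p₀
      = 1 := by
    have : ∀ᵐ x ∂p₀, ENNReal.ofReal (Real.exp (-shiftedLogPartition ε f x)) * normPartition ε f x
        = 1 := by
      filter_upwards [hfin] with x hx
      have h0 := normPartition_ne_zero (ε := ε) hf.1 x
      rw [shiftedLogPartition_eq hε hf.1 hx, Real.exp_neg, Real.exp_log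
        (ENNReal.toReal_pos h0 hx), ENNReal.ofReal_inv_of_pos (ENNReal.toReal_pos h0 hx),
        ENNReal.ofReal_toReal hx, ENNReal.inv_mul_cancel h0 hx]
    rw [lintegral_congr_ae this]
    simp
  obtain ⟨t, htm, -, hw, ht⟩ := weakDual_eq_varDual_add hε hf hpot (by rw [hG]; simp)
  refine ⟨hpot, ?_⟩
  have ht0 : ∫⁻ x, t x ∂p₀ = 0 := by
    rw [lintegral_eq_zero_iff' htm]
    filter_upwards [ht] with x hx
    exact hx.2.2 rfl
  rw [hw, ht0]
  simp

/-- The weak dual objective of a bounded potential in terms of the abstract dual functional. -/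
lemma weakDual_of_isBddMeasurable [IsProbabilityMeasure p₀] [IsProbabilityMeasure p₁] (hε : 0 < ε)
    {F : E D → ℝ} (hF : IsBddMeasurable F) :
    (fun y => ε * F y) ∈ potentials p₁ ∧ weakDual ε p₀ p₁ (fun y => ε * F y)
      = ((ε * dualValue p₀ p₁ (gaussKernel D ε) F
        - ε * ((D : ℝ) / 2 * Real.log (2 * Real.pi * ε)) : ℝ) : EReal) := by
  have hb := hF.const_mul ε
  refine ⟨⟨hb.1, hb.integrable _⟩, ?_⟩
  set L : ℝ := (D : ℝ) / 2 * Real.log (2 * Real.pi * ε) with hL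
  have hdiv : (fun y => ε * F y / ε) = F := by
    ext y
    field_simp
  have hfin : ∀ x, normPartition ε (fun y => ε * F y) x ≠ ⊤ := fun x => by
    rw [← integrable_exp_iff_normPartition hb.1]
    have : (fun y => Real.exp (ε * F y / ε)) = fun y => Real.exp (F y) := by
      ext y
      rw [congrFun hdiv y]
    rw [this]
    exact hF.exp.integrable _
  have hlog : ∀ x, -ENNReal.log (partition ε (fun y => ε * F y) x)
      = ((-L - logMgf (gaussKernel D ε) F x : ℝ) : EReal) := fun x => by
    rw [neg_log_partition hε hb.1 (hfin x), ← integral_exp_eq_normPartition hb.1, logMgf]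
    simp only [congrFun hdiv, hL]
  have hli := (isBddMeasurable_logMgf (κ := gaussKernel D ε) hF).integrable p₀
  rw [weakDual]
  simp only [hlog]
  rw [extIntegral_coe (a := fun x => -L - logMgf (gaussKernel D ε) F x)
      ((integrable_const _).sub hli), integral_sub (integrable_const _) hli,
    ← EReal.coe_mul, ← EReal.coe_add, integral_const_mul, dualValue]
  congr 1
  simp only [integral_const, probReal_univ, smul_eq_mul, one_mul]
  ring

end DualObjectives

/-! ### Weak duality with remainder -/

section WeakDuality

open InformationTheory

variable {D : ℕ} {ε : ℝ} {f : E D → ℝ} {p₀ p₁ : Measure (E D)} [IsProbabilityMeasure p₀]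
  {π : ProbabilityMeasure (E D × E D)}

/-- Weak duality with remainder: the gap between the transport objective of a coupling and the dual
objective of `f` is `ε` times the mean relative entropy of the conditional distributions of the
coupling with respect to the Gibbs measures of `f`. -/
lemma eotObjective_eq_weakDual_add (hε : 0 < ε) (hf : f ∈ potentials p₁)
    (hπ : π ∈ couplings p₀ p₁)
    (hK : klDiv (π : Measure (E D × E D)) (p₀ ⊗ₘ gaussKernel D ε) ≠ ⊤) :
    ∃ s : E D → ℝ≥0∞, AEMeasurable s p₀ ∧ (∃ r : ℝ, eotObjective ε p₀ π = r) ∧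
      weakDual ε p₀ p₁ f
        = eotObjective ε p₀ π - (ε : EReal) * ((∫⁻ x, s x ∂p₀ : ℝ≥0∞) : EReal) ∧
      ∀ᵐ x ∂p₀, s x = 0 → normPartition ε f x ≠ ⊤ ∧
        conditional π x = (gaussKernel D ε x).tilted (fun y => f y / ε) := by
  classical
  obtain ⟨hfm, hfi⟩ := hf
  obtain ⟨hπ0, hπ1⟩ := hπ
  set L : ℝ := (D : ℝ) / 2 * Real.log (2 * Real.pi * ε) with hL
  set k : E D → ℝ≥0∞ := fun x => klDiv (conditional π x) (gaussKernel D ε x) with hk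
  have hkm : Measurable k := measurable_klDiv_kernel _ _
  have hkK : ∫⁻ x, k x ∂p₀ = klDiv (π : Measure (E D × E D)) (p₀ ⊗ₘ gaussKernel D ε) :=
    (klDiv_eq_lintegral_conditional hπ0).symm
  have hkfin : ∫⁻ x, k x ∂p₀ ≠ ⊤ := by rwa [hkK]
  have hki : Integrable (fun x => (k x).toReal) p₀ :=
    integrable_toReal_of_lintegral_ne_top hkm.aemeasurable hkfin
  have hkint : ∫ x, (k x).toReal ∂p₀
      = (klDiv (π : Measure (E D × E D)) (p₀ ⊗ₘ gaussKernel D ε)).toReal := by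
    rw [integral_toReal hkm.aemeasurable (ae_lt_top hkm hkfin), hkK]
  -- the potential is integrable for almost every conditional distribution
  have hfπ : Integrable (fun p : E D × E D => f p.2)
      (p₀ ⊗ₘ (π : Measure (E D × E D)).condKernel) := by
    rw [compProd_conditional hπ0]
    rw [← hπ1] at hfi
    exact hfi.comp_measurable measurable_snd
  have hfx := ((Measure.integrable_compProd_iff hfπ.1).1 hfπ).1
  set F : E D → ℝ := fun x => ∫ y, f y ∂(conditional π x) with hF
  have hFi : Integrable F p₀ := hfπ.integral_compProd
  have hFint : ∫ x, F x ∂p₀ = ∫ y, f y ∂p₁ := by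
    simp only [hF, conditional]
    rw [← Measure.integral_compProd hfπ, compProd_conditional hπ0, ← hπ1, Measure.snd,
      integral_map measurable_snd.aemeasurable hfm.aestronglyMeasurable]
  set a : E D → ℝ := fun x => (k x).toReal - F x / ε - L with ha
  have hai : Integrable a p₀ := (hki.sub (hFi.div_const ε)).sub (integrable_const L)
  set s : E D → ℝ≥0∞ := fun x => if normPartition ε f x = ⊤ then ⊤ else
    klDiv (conditional π x) ((gaussKernel D ε x).tilted fun y => f y / ε) with hs
  have hlog : ∀ᵐ x ∂p₀, -ENNReal.log (partition ε f x) = (a x : EReal) - (s x : EReal) := by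
    filter_upwards [ae_lt_top hkm hkfin, hfx] with x hx hx'
    by_cases h : normPartition ε f x = ⊤
    · rw [neg_log_partition_of_eq_top hε hfm h, hs]
      simp [h]
    · have : IsProbabilityMeasure (conditional π x) := by
        unfold conditional; infer_instance
      have hx'' : Integrable (fun y => f y / ε) (conditional π x) := Integrable.div_const hx' ε
      obtain ⟨h1, h2⟩ := klDiv_tilted_right hx'' ((integrable_exp_iff_normPartition hfm x).2 h)
        hx.ne
      have hsx : s x = klDiv (conditional π x)
        ((gaussKernel D ε x).tilted fun y => f y / ε) := if_neg h
      rw [neg_log_partition hε hfm h, hsx, ← EReal.coe_ennreal_toReal h1, ← EReal.coe_sub]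
      congr 1
      rw [integral_exp_eq_normPartition hfm, integral_div] at h2
      simp only [ha, hk, hF]
      rw [h2]
      ring
  have hsm : AEMeasurable s p₀ := by
    have hpm : Measurable fun x => ENNReal.log (partition ε f x) :=
      ENNReal.measurable_log.comp (measurable_partition hε hfm)
    refine AEMeasurable.congr
      (f := fun x => ((a x : EReal) + ENNReal.log (partition ε f x)).toENNReal) ?_ ?_
    · exact (hai.aemeasurable.coe_real_ereal.add hpm.aemeasurable).ereal_toENNReal
    · filter_upwards [hlog] with x hx
      have h1 : ENNReal.log (partition ε f x) = (s x : EReal) - (a x : EReal) := by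
        rw [← neg_neg (ENNReal.log _), hx, EReal.neg_sub (Or.inl (EReal.coe_ne_bot _))
          (Or.inl (EReal.coe_ne_top _)), add_comm, sub_eq_add_neg]
      rw [h1]
      rcases eq_or_ne (s x) ⊤ with h2 | h2
      · simp [h2]
      · rw [← EReal.coe_ennreal_toReal h2, ← EReal.coe_sub, ← EReal.coe_add, add_sub_cancel,
          EReal.real_coe_toENNReal, ENNReal.ofReal_toReal h2]
  have hobj : eotObjective ε p₀ π = ((ε * (klDiv (π : Measure (E D × E D))
      (p₀ ⊗ₘ gaussKernel D ε)).toReal - ε * L : ℝ) : EReal) := by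
    rw [eotObjective_eq_klDiv hε hπ0, EReal.coe_sub, EReal.coe_mul ε (ENNReal.toReal _),
      EReal.coe_ennreal_toReal hK]
  refine ⟨s, hsm, ⟨_, hobj⟩, ?_, ?_⟩
  · rw [weakDual, extIntegral_congr_ae hlog, extIntegral_sub hai hsm, hobj,
      EReal.mul_sub_of_nonneg_of_ne_top (by exact_mod_cast hε.le) (EReal.coe_ne_top _),
      ← EReal.coe_mul, sub_eq_add_neg, ← add_assoc, ← EReal.coe_add, ← sub_eq_add_neg]
    congr 2
    rw [integral_sub (f := fun x => (k x).toReal - F x / ε) (hki.sub (hFi.div_const ε))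
      (integrable_const L), integral_sub hki (hFi.div_const ε), integral_div, hFint, hkint]
    simp only [integral_const, probReal_univ, smul_eq_mul, one_mul]
    field_simp
    ring
  · refine ae_of_all _ fun x hx => ?_
    have h : normPartition ε f x ≠ ⊤ := fun h => by simp [hs, h] at hx
    have : IsProbabilityMeasure (conditional π x) := by
      unfold conditional; infer_instance
    have : IsProbabilityMeasure ((gaussKernel D ε x).tilted fun y => f y / ε) :=
      isProbabilityMeasure_tilted ((integrable_exp_iff_normPartition hfm x).2 h)
    simp only [hs, if_neg h] at hx
    exact ⟨h, klDiv_eq_zero_iff.1 hx⟩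

/-- Weak duality. -/
lemma weakDual_le_eotObjective (hε : 0 < ε) (hf : f ∈ potentials p₁) (hπ : π ∈ couplings p₀ p₁) :
    weakDual ε p₀ p₁ f ≤ eotObjective ε p₀ π := by
  by_cases hK : klDiv (π : Measure (E D × E D)) (p₀ ⊗ₘ gaussKernel D ε) = ⊤
  · rw [eotObjective_eq_klDiv hε hπ.1, hK, EReal.coe_ennreal_top, EReal.coe_mul_top_of_pos hε,
      EReal.top_sub_coe]
    exact le_top
  · obtain ⟨s, -, -, hw, -⟩ := eotObjective_eq_weakDual_add hε hf hπ hK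
    rw [hw]
    refine EReal.sub_le_of_le_add' ?_
    calc _ = 0 + eotObjective ε p₀ π := (zero_add _).symm
      _ ≤ _ := by
        gcongr
        exact mul_nonneg (by exact_mod_cast hε.le) (EReal.coe_ennreal_nonneg _)

end WeakDuality

/-! ### Strong duality and uniqueness of the plan -/

section StrongDuality

open InformationTheory

variable {D : ℕ} {ε : ℝ} {p₀ p₁ : Measure (E D)} [IsProbabilityMeasure p₀]

lemma iSup_varDual_le_iSup_weakDual (hε : 0 < ε) :
    (⨆ f ∈ potentials p₁, ⨆ ξ ∈ potentials p₀, varDual ε p₀ p₁ f ξ)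
      ≤ ⨆ f ∈ potentials p₁, weakDual ε p₀ p₁ f :=
  iSup₂_mono fun _ hf => iSup₂_le fun _ hξ => varDual_le_weakDual hε hf hξ

lemma iSup_weakDual_le_eot (hε : 0 < ε) :
    (⨆ f ∈ potentials p₁, weakDual ε p₀ p₁ f) ≤ eot ε p₀ p₁ :=
  iSup₂_le fun _ hf => le_iInf₂ fun _ hπ => weakDual_le_eotObjective hε hf hπ

lemma klDiv_ne_top_of_eotObjective_ne_top (hε : 0 < ε) {π : ProbabilityMeasure (E D × E D)}
    (hπ : (π : Measure (E D × E D)).fst = p₀) (h : eotObjective ε p₀ π ≠ ⊤) :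
    klDiv (π : Measure (E D × E D)) (p₀ ⊗ₘ gaussKernel D ε) ≠ ⊤ := by
  intro hK
  rw [eotObjective_eq_klDiv hε hπ, hK, EReal.coe_ennreal_top, EReal.coe_mul_top_of_pos hε,
    EReal.top_sub_coe] at h
  exact h rfl

/-- Comparison of transport objectives of couplings is comparison of relative entropies. -/
lemma klDiv_le_of_eotObjective_le (hε : 0 < ε) {π π' : ProbabilityMeasure (E D × E D)}
    (hπ : (π : Measure (E D × E D)).fst = p₀) (hπ' : (π' : Measure (E D × E D)).fst = p₀)
    (h : eotObjective ε p₀ π ≤ eotObjective ε p₀ π') :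
    klDiv (π : Measure (E D × E D)) (p₀ ⊗ₘ gaussKernel D ε)
      ≤ klDiv (π' : Measure (E D × E D)) (p₀ ⊗ₘ gaussKernel D ε) := by
  by_cases hK' : klDiv (π' : Measure (E D × E D)) (p₀ ⊗ₘ gaussKernel D ε) = ⊤
  · rw [hK']
    exact le_top
  have hobj' := eotObjective_eq_klDiv hε hπ'
  rw [← EReal.coe_ennreal_toReal hK', ← EReal.coe_mul, ← EReal.coe_sub] at hobj'
  have hK : klDiv (π : Measure (E D × E D)) (p₀ ⊗ₘ gaussKernel D ε) ≠ ⊤ :=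
    klDiv_ne_top_of_eotObjective_ne_top hε hπ
      (ne_top_of_le_ne_top (by rw [hobj']; exact EReal.coe_ne_top _) h)
  rw [hobj', eotObjective_eq_klDiv hε hπ, ← EReal.coe_ennreal_toReal hK, ← EReal.coe_mul,
    ← EReal.coe_sub, EReal.coe_le_coe_iff] at h
  exact (ENNReal.toReal_le_toReal hK hK').1 (le_of_mul_le_mul_left (by linarith) hε)

/-- The EOT plan is unique, since the midpoint of two couplings is a coupling. -/
lemma IsEOTPlan.eq (hε : 0 < ε) (hfin : eot ε p₀ p₁ ≠ ⊤) {π π' : ProbabilityMeasure (E D × E D)}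
    (hπ : IsEOTPlan ε p₀ p₁ π) (hπ' : IsEOTPlan ε p₀ p₁ π') : π' = π := by
  obtain ⟨⟨hπ0, hπ1⟩, hπe⟩ := hπ
  obtain ⟨⟨hπ0', hπ1'⟩, hπe'⟩ := hπ'
  have hK := klDiv_ne_top_of_eotObjective_ne_top hε hπ0 (hπe ▸ hfin)
  set m : Measure (E D × E D) := (2 : ℝ≥0∞)⁻¹ • (π' : Measure (E D × E D))
    + (2 : ℝ≥0∞)⁻¹ • (π : Measure (E D × E D)) with hm
  have hmp : IsProbabilityMeasure m := by
    constructor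
    simp [hm, ENNReal.inv_two_add_inv_two]
  have half : ∀ p : Measure (E D), (2 : ℝ≥0∞)⁻¹ • p + (2 : ℝ≥0∞)⁻¹ • p = p := fun p => by
    rw [← add_smul, ENNReal.inv_two_add_inv_two, one_smul]
  have hm0 : m.fst = p₀ := by
    rw [hm, Measure.fst_add, Measure.fst, Measure.fst, Measure.map_smul, Measure.map_smul]
    change (2 : ℝ≥0∞)⁻¹ • (π' : Measure (E D × E D)).fst
      + (2 : ℝ≥0∞)⁻¹ • (π : Measure (E D × E D)).fst = p₀
    rw [hπ0, hπ0', half]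
  have hm1 : m.snd = p₁ := by
    rw [hm, Measure.snd_add, Measure.snd, Measure.snd, Measure.map_smul, Measure.map_smul]
    change (2 : ℝ≥0∞)⁻¹ • (π' : Measure (E D × E D)).snd
      + (2 : ℝ≥0∞)⁻¹ • (π : Measure (E D × E D)).snd = p₁
    rw [hπ1, hπ1', half]
  have hle : ∀ ρ : ProbabilityMeasure (E D × E D), ρ ∈ couplings p₀ p₁ →
      eotObjective ε p₀ π ≤ eotObjective ε p₀ ρ := fun ρ hρ => hπe ▸ iInf₂_le ρ hρ
  have := π.2
  have := π'.2
  refine Subtype.ext (eq_of_klDiv_le_klDiv_midpoint hK ?_ rfl ?_)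
  · exact le_antisymm (klDiv_le_of_eotObjective_le hε hπ0' hπ0 (hπe'.trans hπe.symm).le)
      (klDiv_le_of_eotObjective_le hε hπ0 hπ0' (hπe.trans hπe'.symm).le)
  · exact klDiv_le_of_eotObjective_le (π' := ⟨m, hmp⟩) hε hπ0 hm0 (hle ⟨m, hmp⟩ ⟨hm0, hm1⟩)

variable [IsProbabilityMeasure p₁]

/-- Bounded potentials give admissible pairs for the variational problem, with a bounded second
potential. -/
lemma dualValue_le_iSup_varDual (hε : 0 < ε) {F : E D → ℝ} (hF : IsBddMeasurable F) :
    ((ε * dualValue p₀ p₁ (gaussKernel D ε) F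
        - ε * ((D : ℝ) / 2 * Real.log (2 * Real.pi * ε)) : ℝ) : EReal)
      ≤ ⨆ f ∈ potentials p₁, ⨆ ξ ∈ potentials p₀, varDual ε p₀ p₁ f ξ := by
  obtain ⟨hpot, hval⟩ := weakDual_of_isBddMeasurable (p₀ := p₀) (p₁ := p₁) hε hF
  obtain ⟨hξ, hvar⟩ := varDual_shiftedLogPartition hε hpot (by rw [hval]; exact EReal.coe_ne_bot _)
    (by rw [hval]; exact EReal.coe_ne_top _)
  rw [← hval, ← hvar]
  exact le_iSup₂_of_le _ hpot (le_iSup₂_of_le _ hξ le_rfl)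

/-- If the variational dual value is not `+∞`, then some coupling has transport objective at most
this value. -/
lemma exists_coupling_eotObjective_le (hε : 0 < ε)
    (h : (⨆ f ∈ potentials p₁, ⨆ ξ ∈ potentials p₀, varDual ε p₀ p₁ f ξ) ≠ ⊤) :
    ∃ π ∈ couplings p₀ p₁,
      klDiv (π : Measure (E D × E D)) (p₀ ⊗ₘ gaussKernel D ε) ≠ ⊤ ∧
      eotObjective ε p₀ π ≤ ⨆ f ∈ potentials p₁, ⨆ ξ ∈ potentials p₀, varDual ε p₀ p₁ f ξ := by
  set V := ⨆ f ∈ potentials p₁, ⨆ ξ ∈ potentials p₀, varDual ε p₀ p₁ f ξ with hV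
  set L : ℝ := (D : ℝ) / 2 * Real.log (2 * Real.pi * ε) with hL
  set S := {r | ∃ F, IsBddMeasurable F ∧ dualValue p₀ p₁ (gaussKernel D ε) F = r} with hS
  have h0 : (0 : ℝ) ∈ S := ⟨fun _ => 0, IsBddMeasurable.const 0, by simp [dualValue, logMgf]⟩
  have hbot : V ≠ ⊥ := fun hb => by
    have := dualValue_le_iSup_varDual (p₀ := p₀) (p₁ := p₁) hε (IsBddMeasurable.const 0)
    rw [← hV, hb, le_bot_iff] at this
    exact EReal.coe_ne_bot _ this
  obtain ⟨v, hv⟩ : ∃ v : ℝ, V = v := ⟨_, (EReal.coe_toReal h hbot).symm⟩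
  have hle : ∀ r ∈ S, r ≤ (v + ε * L) / ε := by
    rintro r ⟨F, hF, rfl⟩
    have := dualValue_le_iSup_varDual (p₀ := p₀) (p₁ := p₁) hε hF
    rw [← hV, hv, EReal.coe_le_coe_iff] at this
    rw [le_div_iff₀ hε, hL]
    linarith
  have hlub := Real.isLUB_sSup ⟨0, h0⟩ ⟨_, hle⟩
  obtain ⟨π, hπ, hfst, hsnd, hkl⟩ := exists_coupling_klDiv_le hlub
  set P : ProbabilityMeasure (E D × E D) := ⟨π, hπ⟩ with hP
  refine ⟨P, ⟨hfst, hsnd⟩, ne_top_of_le_ne_top ENNReal.ofReal_ne_top hkl, ?_⟩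
  have hs0 : 0 ≤ sSup S := hlub.1 h0
  have hsv : sSup S ≤ (v + ε * L) / ε := hlub.2 hle
  rw [le_div_iff₀ hε] at hsv
  have hkl' : (klDiv π (p₀ ⊗ₘ gaussKernel D ε)).toReal ≤ sSup S :=
    ENNReal.toReal_le_of_le_ofReal hs0 hkl
  rw [eotObjective_eq_klDiv (π := P) hε hfst, hv]
  change (ε : EReal) * (klDiv π (p₀ ⊗ₘ gaussKernel D ε) : EReal) - _ ≤ _
  rw [← EReal.coe_ennreal_toReal (ne_top_of_le_ne_top ENNReal.ofReal_ne_top hkl), ← EReal.coe_mul,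
    ← EReal.coe_sub, EReal.coe_le_coe_iff]
  have := mul_le_mul_of_nonneg_left hkl' hε.le
  rw [hL] at hsv
  linarith

/-- Strong duality. -/
lemma eot_eq_iSup_varDual (hε : 0 < ε) :
    eot ε p₀ p₁ = ⨆ f ∈ potentials p₁, ⨆ ξ ∈ potentials p₀, varDual ε p₀ p₁ f ξ := by
  refine le_antisymm ?_ ((iSup_varDual_le_iSup_weakDual hε).trans (iSup_weakDual_le_eot hε))
  by_cases h : (⨆ f ∈ potentials p₁, ⨆ ξ ∈ potentials p₀, varDual ε p₀ p₁ f ξ) = ⊤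
  · rw [h]
    exact le_top
  · obtain ⟨π, hπ, -, hle⟩ := exists_coupling_eotObjective_le hε h
    exact (iInf₂_le π hπ).trans hle

lemma iSup_weakDual_eq_iSup_varDual (hε : 0 < ε) :
    (⨆ f ∈ potentials p₁, weakDual ε p₀ p₁ f)
      = ⨆ f ∈ potentials p₁, ⨆ ξ ∈ potentials p₀, varDual ε p₀ p₁ f ξ :=
  le_antisymm ((iSup_weakDual_le_eot hε).trans (eot_eq_iSup_varDual hε).le)
    (iSup_varDual_le_iSup_weakDual hε)

lemma eot_ne_bot (hε : 0 < ε) : eot ε p₀ p₁ ≠ ⊥ := fun hb => by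
  have := dualValue_le_iSup_varDual (p₀ := p₀) (p₁ := p₁) hε (IsBddMeasurable.const 0)
  rw [← eot_eq_iSup_varDual hε, hb, le_bot_iff] at this
  exact EReal.coe_ne_bot _ this

end StrongDuality

end EntropicOT

theorem mainTheorem1 (D : ℕ) (ε : ℝ) (hε : 0 < ε)
    (p₀ p₁ : Measure (EntropicOT.E D)) [IsProbabilityMeasure p₀] [IsProbabilityMeasure p₁]
    (hp₀ : p₀ ≪ volume) (hp₁ : p₁ ≪ volume) :
    EntropicOT.eot ε p₀ p₁
        = ⨆ f ∈ EntropicOT.potentials p₁, EntropicOT.weakDual ε p₀ p₁ f ∧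
    (⨆ f ∈ EntropicOT.potentials p₁, EntropicOT.weakDual ε p₀ p₁ f)
        = (⨆ f ∈ EntropicOT.potentials p₁, ⨆ ξ ∈ EntropicOT.potentials p₀,
            EntropicOT.varDual ε p₀ p₁ f ξ) ∧
    (EntropicOT.eot ε p₀ p₁ ≠ ⊤ →
      (∀ f, EntropicOT.IsWeakDualOptimal ε p₀ p₁ f →
        EntropicOT.IsVarDualOptimal ε p₀ p₁ f (EntropicOT.shiftedLogPartition ε f)) ∧
      ∃ π, EntropicOT.IsEOTPlan ε p₀ p₁ π ∧
        (∀ π', EntropicOT.IsEOTPlan ε p₀ p₁ π' → π' = π) ∧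
        ∀ f ξ, EntropicOT.IsVarDualOptimal ε p₀ p₁ f ξ →
          EntropicOT.IsWeakDualOptimal ε p₀ p₁ f ∧
          ξ =ᵐ[p₀] EntropicOT.shiftedLogPartition ε f ∧
          ∀ᵐ x₀ ∂p₀, EntropicOT.conditional π x₀
            = volume.withDensity
                (fun x₁ => ENNReal.ofReal (EntropicOT.gibbsDensity ε f ξ x₀ x₁))) := by
  have hWV := EntropicOT.iSup_weakDual_eq_iSup_varDual (p₀ := p₀) (p₁ := p₁) hε
  have hEV := EntropicOT.eot_eq_iSup_varDual (p₀ := p₀) (p₁ := p₁) hε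
  refine ⟨hEV.trans hWV.symm, hWV, fun hfin => ⟨fun f hf => ?_, ?_⟩⟩
  · have hval : EntropicOT.weakDual ε p₀ p₁ f = EntropicOT.eot ε p₀ p₁ := by
      rw [hEV, ← hWV]
      exact le_antisymm (le_iSup₂_of_le f hf.1 le_rfl) (iSup₂_le hf.2)
    obtain ⟨hξ, hvar⟩ := EntropicOT.varDual_shiftedLogPartition hε hf.1
      (hval ▸ EntropicOT.eot_ne_bot hε) (hval ▸ hfin)
    refine ⟨hf.1, hξ, fun g hg ζ hζ => ?_⟩
    rw [hvar]
    exact (EntropicOT.varDual_le_weakDual hε hg hζ).trans (hf.2 g hg)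
  · obtain ⟨π, hπ, hK, hle⟩ := EntropicOT.exists_coupling_eotObjective_le (p₀ := p₀) (p₁ := p₁) hε
      (hEV ▸ hfin)
    have hplan : EntropicOT.IsEOTPlan ε p₀ p₁ π :=
      ⟨hπ, le_antisymm (hle.trans hEV.ge) (iInf₂_le π hπ)⟩
    refine ⟨π, hplan, fun π' hπ' => EntropicOT.IsEOTPlan.eq hε hfin hplan hπ', ?_⟩
    rintro f ξ ⟨hf, hξ, hopt⟩
    have hval : EntropicOT.varDual ε p₀ p₁ f ξ = EntropicOT.eot ε p₀ p₁ := by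
      rw [hEV]
      exact le_antisymm (le_iSup₂_of_le f hf (le_iSup₂_of_le ξ hξ le_rfl))
        (iSup₂_le fun g hg => iSup₂_le fun ζ hζ => hopt g hg ζ hζ)
    -- a real value of the variational objective excludes an infinite exponential term
    have hG : ∫⁻ x, ENNReal.ofReal (Real.exp (-ξ x)) * EntropicOT.normPartition ε f x ∂p₀ ≠ ⊤ :=
      fun h => EntropicOT.eot_ne_bot (p₀ := p₀) (p₁ := p₁) hε
        (hval.symm.trans (EntropicOT.varDual_eq_bot hε hf.1 h))
    have hweak : EntropicOT.weakDual ε p₀ p₁ f = EntropicOT.eot ε p₀ p₁ := by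
      refine le_antisymm ?_ (hval ▸ EntropicOT.varDual_le_weakDual hε hf hξ)
      exact (le_iSup₂_of_le f hf le_rfl).trans (EntropicOT.iSup_weakDual_le_eot hε)
    obtain ⟨t, htm, ⟨r, hr⟩, hw, ht⟩ := EntropicOT.weakDual_eq_varDual_add hε hf hξ hG
    have ht0 : ∫⁻ x, t x ∂p₀ = 0 := by
      refine EntropicOT.lintegral_eq_zero_of_mul_le_zero hε ?_
      rw [hweak, ← hval, hr] at hw
      refine (EReal.addLECancellable_coe r) ?_
      rw [← hw, add_zero]
    have hξae : ξ =ᵐ[p₀] EntropicOT.shiftedLogPartition ε f := by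
      filter_upwards [ht, (lintegral_eq_zero_iff' htm).1 ht0] with x hx hx'
      exact hx.2.1 hx'
    refine ⟨⟨hf, fun g hg => ?_⟩, hξae, ?_⟩
    · rw [hweak]
      exact (le_iSup₂_of_le g hg le_rfl).trans (EntropicOT.iSup_weakDual_le_eot hε)
    · obtain ⟨s, hsm, ⟨r', hr'⟩, hw', hs⟩ :=
        EntropicOT.eotObjective_eq_weakDual_add hε hf hπ hK
      have hs0 : ∫⁻ x, s x ∂p₀ = 0 := by
        refine EntropicOT.lintegral_eq_zero_of_mul_le_zero hε ?_
        rw [hweak, ← hplan.2, hr'] at hw'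
        have h1 := (EReal.le_sub_iff_add_le (a := (r' : EReal)) (c := (r' : EReal))
          (b := (ε : EReal) * ((∫⁻ x, s x ∂p₀ : ℝ≥0∞) : EReal)) (Or.inr (EReal.coe_ne_bot _))
          (Or.inr (EReal.coe_ne_top _))).1 hw'.le
        refine (EReal.addLECancellable_coe r') ?_
        rwa [add_zero]
      filter_upwards [hξae, hs, (lintegral_eq_zero_iff' hsm).1 hs0] with x hx hx' hx''
      obtain ⟨h1, h2⟩ := hx' hx''
      rw [h2, EntropicOT.tilted_gaussKernel_eq hε hf.1 h1 hx]
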